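/- Let $H(x,y)=\frac{y^2}{2}-\frac{x^2}{2}+\frac{x^4}{4}$, and for real $h>0$ let $\gamma(h)=\{(x,y)\in\mathbb R^2: H(x,y)=h\}$ be the exterior oval, oriented by the vector field $\dot x=y,\ \dot y=x-x^3$. For $i=0,2$ the complete elliptic integral $$I_i(h)=\oint_{\gamma(h)}x^i y\,dx ,\qquad h>0,$$ extends to an analytic function, again denoted $I_i$, on the domain $\mathcal D=\mathbb C\setminus(-\infty,0]$. Let $\lambda_0,\lambda_2\in\mathbb R$ be not both zero. Then the first Melnikov function $$M_1(h)=\lambda_0 I_0(h)+\lambda_2 I_2(h)$$ has at most two zeros in $\mathcal D$, counted with multiplicity. -/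

import Mathlib

namespace Duffing

/-- The first integral `H = y²/2 - x²/2 + x⁴/4` of the unperturbed Duffing oscillator
`x' = y`, `y' = x - x³`. -/
noncomputable def H (x y : ℝ) : ℝ := y ^ 2 / 2 - x ^ 2 / 2 + x ^ 4 / 4

/-- The largest abscissa on the level curve `{H = h}`, `h > 0`: the positive root of
`x⁴ / 4 - x² / 2 = h`. -/
noncomputable def xmax (h : ℝ) : ℝ := √(1 + √(1 + 4 * h))

/-- The upper half `y = branch h x ≥ 0`, `-xmax h ≤ x ≤ xmax h`, of the level curve `{H = h}`;
the lower half is `y = -branch h x`. -/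
noncomputable def branch (h x : ℝ) : ℝ := √(2 * h + x ^ 2 - x ^ 4 / 2)

/-- For `h > 0` the level set `{H = h}` is the closed curve (the exterior oval `γ(h)`) made of the
graphs of `branch h` and `-branch h` over `[-xmax h, xmax h]`. -/
theorem H_eq_iff {h : ℝ} (hh : 0 < h) (x y : ℝ) :
    H x y = h ↔ x ∈ Set.Icc (-xmax h) (xmax h) ∧ (y = branch h x ∨ y = -branch h x) := by
  have h1 : 0 ≤ 1 + 4 * h := by linarith
  have hr := Real.sq_sqrt h1
  have hr0 := Real.sqrt_nonneg (1 + 4 * h)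
  have hr1 : 1 < √(1 + 4 * h) := by
    rw [Real.lt_sqrt] <;> linarith
  have key : 2 * h + x ^ 2 - x ^ 4 / 2
      = (1 + √(1 + 4 * h) - x ^ 2) * (x ^ 2 + (√(1 + 4 * h) - 1)) / 2 := by
    linear_combination (-1 / 2) * hr
  have hpos : 0 < x ^ 2 + (√(1 + 4 * h) - 1) := by nlinarith [sq_nonneg x]
  have hmem : x ∈ Set.Icc (-xmax h) (xmax h) ↔ 0 ≤ 2 * h + x ^ 2 - x ^ 4 / 2 := by
    rw [Set.mem_Icc, ← abs_le, xmax, Real.le_sqrt (abs_nonneg x) (by linarith), sq_abs, key]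
    constructor
    · intro hx
      have := mul_nonneg (sub_nonneg.2 hx) hpos.le
      linarith
    · intro hx
      by_contra hc
      have := mul_neg_of_neg_of_pos (sub_neg.2 (not_le.1 hc)) hpos
      linarith
  have hH : H x y = h ↔ y ^ 2 = 2 * h + x ^ 2 - x ^ 4 / 2 := by
    unfold H
    constructor <;> intro hx <;> linarith
  rw [hmem, hH, branch]
  constructor
  · intro hy
    have h0 : 0 ≤ 2 * h + x ^ 2 - x ^ 4 / 2 := hy ▸ sq_nonneg y
    refine ⟨h0, sq_eq_sq_iff_eq_or_eq_neg.1 ?_⟩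
    rw [Real.sq_sqrt h0, hy]
  · rintro ⟨h0, rfl | rfl⟩
    · exact Real.sq_sqrt h0
    · rw [neg_sq, Real.sq_sqrt h0]

/-- The complete elliptic integral `∮_{γ(h)} xⁱ y dx`, for real `h > 0`, over the exterior oval
`γ(h) = {H = h}` oriented by the vector field `x' = y`, `y' = x - x³`: the upper half is run
through from left to right and then the lower half from right to left. -/
noncomputable def ovalIntegral (i : ℕ) (h : ℝ) : ℝ :=
  (∫ x in (-xmax h)..(xmax h), x ^ i * branch h x) +
    ∫ x in (xmax h)..(-xmax h), x ^ i * (-branch h x)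

/-- `I` is, on the domain `ℂ ∖ (-∞, 0]` (Mathlib's `Complex.slitPlane`), the analytic
continuation of `h ↦ ∮_{γ(h)} xⁱ y dx`, `h > 0`. -/
def IsAbelianIntegral (i : ℕ) (I : ℂ → ℂ) : Prop :=
  AnalyticOnNhd ℂ I Complex.slitPlane ∧ ∀ h : ℝ, 0 < h → I (h : ℂ) = (ovalIntegral i h : ℂ)

end Duffing

/-! Put `s = √(1 + 4h)`, with positive real part, and let `m₀`, `m₂` be the moments `∫ sinⁿ θ dθ /
√R`, `n = 0, 2`, where `R = (1 + s) sin² θ + (s - 1)`. Substituting `x = √(1 + s) sin θ` and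
integrating by parts expresses `I₀` and `I₂` through `m₀` and `m₂`. The result is `M₁ = u · (p φ + q
h + r)`, where `u = 2√2 (1 + s) m₂`, `φ = (s - 1) m₀ / m₂`, and `p, q, r` are real and not all zero.
Since `u` has no zeros, the problem concerns the second factor only.

The function `φ` is a Pick function: it is real on `(0, ∞)` and maps the upper half-plane into
itself (`isPick_ratio`). Indeed `2 Im ((s - 1) m₀ conj m₂)` is a double integral whose symmetrised
integrand is nonnegative, because `arg R` decreases from `arg (s - 1)` as `sin² θ` grows
(`im_moment_pos`). Moreover `φ` is not affine, since it increases strictly along `(0, ∞)` but only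
like `O(√h)` at infinity.

For a non-affine Pick function the bound holds in general (`IsPick.sum_order_le_two`). If there is a
real zero `x`, divide it out: minus the divided difference of `φ` at `x` is again a Pick function
(`IsPick.neg_dslope`), so the other factor has no nonreal zero and at most one real zero, a simple
one. If there is no real zero, then zeros in the upper half-plane are fixed points of the self-map
`-(p φ + r) / q`, and Schwarz–Pick allows at most one, with multiplier different from `1`
(`IsPick.comb_zero_unique`). Conjugation treats the lower half-plane. -/

section

open Complex Set Filter Metric Topology ComplexConjugate MeasureTheory

/-! ### The upper half-plane and its Cayley transforms -/

namespace Pick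

/-- The open upper half-plane. -/
def upperPlane : Set ℂ := {z | 0 < z.im}

theorem isOpen_upperPlane : IsOpen upperPlane := isOpen_lt continuous_const continuous_im

theorem isPreconnected_upperPlane : IsPreconnected upperPlane :=
  (convex_halfSpace_im_gt 0).isPreconnected

theorem upperPlane_subset_slitPlane : upperPlane ⊆ slitPlane := fun _ hz => Or.inr (ne_of_gt hz)

theorem I_mem_upperPlane : I ∈ upperPlane := by simp [upperPlane]

theorem sub_conj_ne_zero {a z : ℂ} (ha : a ∈ upperPlane) (hz : z ∈ upperPlane) : z - conj a ≠ 0 := by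
  intro h
  have := congrArg im h
  simp only [upperPlane, mem_ofPred_eq, sub_im, conj_im, zero_im] at *
  linarith

theorem normSq_sub_conj (a z : ℂ) :
    normSq (z - conj a) = normSq (z - a) + 4 * z.im * a.im := by
  simp [normSq_apply]; ring

/-- The Cayley transform of the upper half-plane onto the unit disc sending `a` to `0`. -/
noncomputable def cayley (a z : ℂ) : ℂ := (z - a) / (z - conj a)

/-- The inverse of `cayley a`. -/
noncomputable def cayleyInv (a w : ℂ) : ℂ := (a - conj a * w) / (1 - w)

theorem one_sub_ne_zero {w : ℂ} (hw : w ∈ ball (0 : ℂ) 1) : 1 - w ≠ 0 := by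
  intro h
  rw [sub_eq_zero] at h
  simp [← h] at hw

theorem cayley_mem_ball {a z : ℂ} (ha : a ∈ upperPlane) (hz : z ∈ upperPlane) :
    cayley a z ∈ ball (0 : ℂ) 1 := by
  have h1 : 0 < ‖z - conj a‖ := norm_pos_iff.2 (sub_conj_ne_zero ha hz)
  rw [mem_ball_zero_iff, cayley, norm_div, div_lt_one h1]
  have := normSq_sub_conj a z
  rw [normSq_eq_norm_sq, normSq_eq_norm_sq] at this
  have hp : 0 < z.im * a.im := mul_pos hz ha
  exact lt_of_pow_lt_pow_left₀ 2 h1.le (by nlinarith)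

theorem cayleyInv_mem_upperPlane {a w : ℂ} (ha : a ∈ upperPlane) (hw : w ∈ ball (0 : ℂ) 1) :
    cayleyInv a w ∈ upperPlane := by
  have h1 : 0 < normSq (1 - w) := normSq_pos.2 (one_sub_ne_zero hw)
  have h2 : normSq w < 1 := by
    rw [normSq_eq_norm_sq]
    have := mem_ball_zero_iff.1 hw
    nlinarith [norm_nonneg w]
  have : (cayleyInv a w).im = a.im * (1 - normSq w) / normSq (1 - w) := by
    rw [cayleyInv, div_im, ← sub_div]
    congr 1
    simp [normSq_apply]
    ring
  change 0 < (cayleyInv a w).im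
  rw [this]
  have : 0 < a.im := ha
  have : 0 < 1 - normSq w := by linarith
  positivity

theorem cayleyInv_cayley {a z : ℂ} (ha : a ∈ upperPlane) (hz : z ∈ upperPlane) :
    cayleyInv a (cayley a z) = z := by
  have h1 := one_sub_ne_zero (cayley_mem_ball ha hz)
  have h2 := sub_conj_ne_zero ha hz
  rw [cayleyInv, div_eq_iff h1, cayley]
  field_simp
  ring

theorem cayley_injOn {a : ℂ} (ha : a ∈ upperPlane) : InjOn (cayley a) upperPlane :=
  LeftInvOn.injOn (f₁' := cayleyInv a) fun _ hz => cayleyInv_cayley ha hz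

/-! ### The Schwarz–Pick lemma and fixed points of self-maps -/

section SchwarzPick

variable {f : ℂ → ℂ} {a z : ℂ}

/-- A self-map of the upper half-plane, read in the unit disc and normalised to fix `0`. -/
noncomputable def disc (f : ℂ → ℂ) (a w : ℂ) : ℂ := cayley (f a) (f (cayleyInv a w))

theorem disc_zero : disc f a 0 = 0 := by simp [disc, cayley, cayleyInv]

theorem differentiableOn_disc (hd : DifferentiableOn ℂ f upperPlane) (hm : MapsTo f upperPlane upperPlane)
    (ha : a ∈ upperPlane) : DifferentiableOn ℂ (disc f a) (ball 0 1) := by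
  have h1 : DifferentiableOn ℂ (cayleyInv a) (ball 0 1) := by
    refine DifferentiableOn.div (by fun_prop) (by fun_prop) fun w hw => one_sub_ne_zero hw
  have h2 : DifferentiableOn ℂ (fun w => f (cayleyInv a w)) (ball 0 1) :=
    hd.comp h1 fun w hw => cayleyInv_mem_upperPlane ha hw
  exact (h2.sub_const _).div (h2.sub_const _) fun w hw =>
    sub_conj_ne_zero (hm ha) (hm (cayleyInv_mem_upperPlane ha hw))

theorem mapsTo_disc (hm : MapsTo f upperPlane upperPlane) (ha : a ∈ upperPlane) :
    MapsTo (disc f a) (ball 0 1) (ball 0 1) := fun _ hw =>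
  cayley_mem_ball (hm ha) (hm (cayleyInv_mem_upperPlane ha hw))

theorem disc_cayley (ha : a ∈ upperPlane) (hz : z ∈ upperPlane) :
    disc f a (cayley a z) = cayley (f a) (f z) := by
  rw [disc, cayleyInv_cayley ha hz]

/-- The **Schwarz–Pick lemma** for the upper half-plane. -/
theorem norm_cayley_le (hd : DifferentiableOn ℂ f upperPlane) (hm : MapsTo f upperPlane upperPlane)
    (ha : a ∈ upperPlane) (hz : z ∈ upperPlane) : ‖cayley (f a) (f z)‖ ≤ ‖cayley a z‖ := by
  have h := norm_le_norm_of_mapsTo_ball (z := cayley a z) (differentiableOn_disc hd hm ha)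
    ((mapsTo_disc hm ha).mono_right ball_subset_closedBall) disc_zero
    (mem_ball_zero_iff.1 (cayley_mem_ball ha hz))
  rwa [disc_cayley ha hz] at h

/-- This is the equality case of the Schwarz lemma. Taking `w ≠ 0` handles a second fixed point, and
`w = 0` a multiplier equal to `1`. -/
theorem eqOn_id_of_dslope_eq_one (hd : DifferentiableOn ℂ f upperPlane) (hm : MapsTo f upperPlane upperPlane)
    (ha : a ∈ upperPlane) (hfa : f a = a) {w : ℂ} (hw : w ∈ ball (0 : ℂ) 1)
    (h : dslope (disc f a) 0 w = 1) : EqOn f id upperPlane := by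
  have hA := affine_of_mapsTo_ball_of_norm_dslope_eq_div (R₂ := 1)
    (differentiableOn_disc hd hm ha)
    (by rw [disc_zero]; exact (mapsTo_disc hm ha).mono_right ball_subset_closedBall) hw
    (by rw [h]; simp)
  intro z hz
  have := hA (cayley_mem_ball ha hz)
  simp only [disc_cayley ha hz, h, disc_zero, sub_zero, smul_eq_mul, mul_one, zero_add] at this
  rw [hfa] at this
  exact cayley_injOn ha (hm hz) hz this

/-- A self-map of the upper half-plane with two fixed points is the identity. -/
theorem eqOn_id_of_fixed (hd : DifferentiableOn ℂ f upperPlane) (hm : MapsTo f upperPlane upperPlane)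
    (ha : a ∈ upperPlane) (hfa : f a = a) (hz : z ∈ upperPlane) (hfz : f z = z) (hne : z ≠ a) :
    EqOn f id upperPlane := by
  have hc : cayley a z ≠ 0 := by
    rw [cayley]
    exact div_ne_zero (sub_ne_zero.2 hne) (sub_conj_ne_zero ha hz)
  refine eqOn_id_of_dslope_eq_one hd hm ha hfa (cayley_mem_ball ha hz) ?_
  rw [dslope_of_ne _ hc, slope_def_field, disc_zero, disc_cayley ha hz, hfa, hfz, sub_zero,
    div_self hc]

/-- A self-map of the upper half-plane with a fixed point of multiplier `1` is the identity. -/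
theorem eqOn_id_of_deriv (hd : DifferentiableOn ℂ f upperPlane) (hm : MapsTo f upperPlane upperPlane)
    (ha : a ∈ upperPlane) (hfa : f a = a) (h1 : deriv f a = 1) : EqOn f id upperPlane := by
  have h0 : (0 : ℂ) ∈ ball (0 : ℂ) 1 := mem_ball_self one_pos
  refine eqOn_id_of_dslope_eq_one hd hm ha hfa h0 ?_
  rw [dslope_same]
  have hi0 : cayleyInv a 0 = a := by simp [cayleyInv]
  have hne := sub_conj_ne_zero ha ha
  have hinv : HasDerivAt (cayleyInv a) (a - conj a) 0 := by
    have := HasDerivAt.div (((hasDerivAt_id (0 : ℂ)).const_mul (conj a)).const_sub a)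
      ((hasDerivAt_id (0 : ℂ)).const_sub 1) (by simp)
    refine this.congr_deriv ?_
    simp
    ring
  have hf : HasDerivAt f 1 (cayleyInv a 0) := by
    rw [hi0, ← h1]
    exact (hd.differentiableAt (isOpen_upperPlane.mem_nhds ha)).hasDerivAt
  have hcomp : HasDerivAt (fun w => f (cayleyInv a w)) (1 * (a - conj a)) 0 :=
    hf.comp (0 : ℂ) hinv
  have := HasDerivAt.div (hcomp.sub_const (f a)) (hcomp.sub_const (conj (f a)))
    (by simpa [hi0, hfa] using hne)
  refine (this.congr_deriv ?_).deriv
  simp only [hi0, hfa]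
  field_simp
  ring

end SchwarzPick

/-! ### Pick functions on the slit plane -/

/-- Holomorphic functions on the slit plane which commute with complex conjugation and map the
upper half-plane into itself. -/
structure IsPick (φ : ℂ → ℂ) : Prop where
  diff : DifferentiableOn ℂ φ slitPlane
  mapsTo : MapsTo φ upperPlane upperPlane
  map_conj : ∀ z ∈ slitPlane, φ (conj z) = conj (φ z)

variable {φ : ℂ → ℂ}

theorem ofReal_mem {x : ℝ} (hx : 0 < x) : (x : ℂ) ∈ slitPlane := Or.inl (by simpa using hx)

theorem conj_mem {z : ℂ} (hz : z ∈ slitPlane) : conj z ∈ slitPlane := by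
  rw [mem_slitPlane_iff] at *
  simpa using hz

theorem mem_slitPlane_cases {z : ℂ} (hz : z ∈ slitPlane) :
    z ∈ upperPlane ∨ conj z ∈ upperPlane ∨ ∃ x : ℝ, 0 < x ∧ z = x := by
  rcases lt_trichotomy z.im 0 with h | h | h
  · right; left; simpa [upperPlane] using h
  · right; right
    refine ⟨z.re, ?_, Complex.ext (by simp) (by simp [h])⟩
    rcases hz with h' | h'
    · exact h'
    · exact absurd h h'
  · exact Or.inl h

namespace IsPick

theorem im_ofReal (h : IsPick φ) {x : ℝ} (hx : 0 < x) : (φ x).im = 0 := by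
  have := h.map_conj x (ofReal_mem hx)
  rw [conj_ofReal] at this
  exact conj_eq_iff_im.1 this.symm

theorem hasDerivAt (h : IsPick φ) {z : ℂ} (hz : z ∈ slitPlane) : HasDerivAt φ (deriv φ z) z :=
  (h.diff.differentiableAt (isOpen_slitPlane.mem_nhds hz)).hasDerivAt

theorem hasDerivAt_ofReal (h : IsPick φ) {x : ℝ} (hx : 0 < x) :
    HasDerivAt (fun t : ℝ => φ t) (deriv φ x) x :=
  (h.hasDerivAt (ofReal_mem hx)).comp_ofReal

theorem im_deriv (h : IsPick φ) {x : ℝ} (hx : 0 < x) : (deriv φ x).im = 0 := by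
  have h1 : HasDerivAt (fun t : ℝ => (φ t).im) (deriv φ x).im x :=
    imCLM.hasFDerivAt.comp_hasDerivAt x (h.hasDerivAt_ofReal hx)
  have h2 : HasDerivAt (fun t : ℝ => (φ t).im) 0 x := by
    refine (hasDerivAt_const x (0 : ℝ)).congr_of_eventuallyEq ?_
    filter_upwards [lt_mem_nhds hx] with t ht
    exact h.im_ofReal ht
  exact h1.unique h2

/-- Schwarz–Pick with base point `I`, rewritten through `1 - ‖cayley a z‖² = 4 Im z Im a / ‖z - conj
a‖²`. The left side stays positive as `z` approaches the positive axis, which forces a positive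
derivative there. -/
theorem im_lower_bound (h : IsPick φ) {z : ℂ} (hz : z ∈ upperPlane) :
    normSq (φ z - conj (φ I)) / (normSq (z - conj I) * (φ I).im) ≤ (φ z).im / z.im := by
  have hI := I_mem_upperPlane
  have hs := norm_cayley_le (h.diff.mono upperPlane_subset_slitPlane) h.mapsTo hI hz
  rw [cayley, cayley, norm_div, norm_div] at hs
  have e1 := normSq_sub_conj I z
  have e2 := normSq_sub_conj (φ I) (φ z)
  have p1 : 0 < normSq (z - conj I) := normSq_pos.2 (sub_conj_ne_zero hI hz)
  have p2 : 0 < normSq (φ z - conj (φ I)) :=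
    normSq_pos.2 (sub_conj_ne_zero (h.mapsTo hI) (h.mapsTo hz))
  have hs2 := pow_le_pow_left₀ (by positivity) hs 2
  rw [div_pow, div_pow, ← normSq_eq_norm_sq, ← normSq_eq_norm_sq, ← normSq_eq_norm_sq,
    ← normSq_eq_norm_sq, div_le_div_iff₀ p2 p1] at hs2
  have hzi : 0 < z.im := hz
  have hφ : 0 < (φ I).im := h.mapsTo hI
  rw [div_le_div_iff₀ (by positivity) hzi]
  simp only [I_im, mul_one] at e1
  have k1 : normSq (z - I) = normSq (z - conj I) - 4 * z.im := by linarith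
  have k2 : normSq (φ z - φ I) = normSq (φ z - conj (φ I)) - 4 * (φ z).im * (φ I).im := by linarith
  rw [k1, k2] at hs2
  nlinarith

/-- Along the vertical line through `x`, the quotient `Im φ / Im z` tends to `Re φ'(x)`, because `φ
x` is real. The limit of the bound in `im_lower_bound` is strictly positive. -/
theorem re_deriv_pos (h : IsPick φ) {x : ℝ} (hx : 0 < x) : 0 < (deriv φ x).re := by
  have hl : HasDerivAt (fun t : ℝ => (x : ℂ) + t * I) I 0 := by
    simpa using ((hasDerivAt_id (0 : ℝ)).ofReal_comp.mul_const I).const_add (x : ℂ)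
  have h0 : HasDerivAt φ (deriv φ x) ((x : ℂ) + ((0 : ℝ) : ℂ) * I) := by
    simpa using h.hasDerivAt (ofReal_mem hx)
  have h1 : HasDerivAt (fun t : ℝ => φ ((x : ℂ) + t * I)) (deriv φ x * I) 0 := h0.comp (0 : ℝ) hl
  have h2 : HasDerivAt (fun t : ℝ => (φ ((x : ℂ) + t * I)).im) (deriv φ x).re 0 := by
    have := imCLM.hasFDerivAt.comp_hasDerivAt (0 : ℝ) h1
    simp only [imCLM_apply, mul_I_im] at this
    exact this
  have h3 : Tendsto (fun t : ℝ => (φ ((x : ℂ) + t * I)).im / t) (𝓝[>] 0) (𝓝 (deriv φ x).re) := by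
    have := (hasDerivAt_iff_tendsto_slope.1 h2).mono_left
      (nhdsWithin_mono (0 : ℝ) (fun t (ht : 0 < t) => ne_of_gt ht))
    refine this.congr fun t => ?_
    simp [slope_def_field, h.im_ofReal hx]
  have hcont : ContinuousAt (fun t : ℝ => normSq (φ ((x : ℂ) + t * I) - conj (φ I)) /
      (normSq ((x : ℂ) + t * I - conj I) * (φ I).im)) 0 := by
    have hI : (0 : ℝ) < (φ I).im := h.mapsTo I_mem_upperPlane
    refine ContinuousAt.div ?_ ?_ ?_
    · exact continuous_normSq.continuousAt.comp (h1.continuousAt.sub continuousAt_const)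
    · exact (Continuous.continuousAt (by fun_prop))
    · refine mul_ne_zero (fun h' => ?_) hI.ne'
      rw [normSq_eq_zero] at h'
      simpa using congrArg im h'
  have hlim := hcont.tendsto.mono_left (nhdsWithin_le_nhds (s := Ioi 0))
  have hle := le_of_tendsto_of_tendsto hlim h3 (by
    filter_upwards [self_mem_nhdsWithin] with t ht
    have := h.im_lower_bound (z := (x : ℂ) + t * I) (by simpa [upperPlane] using ht)
    simpa using this)
  refine lt_of_lt_of_le ?_ hle
  have hI : (0 : ℝ) < (φ I).im := h.mapsTo I_mem_upperPlane
  refine div_pos (normSq_pos.2 fun h' => ?_) (mul_pos (normSq_pos.2 fun h' => ?_) hI)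
  · have := congrArg im h'
    simp [h.im_ofReal hx] at this
    exact hI.ne' this
  · simpa using congrArg im h'

theorem strictMonoOn (h : IsPick φ) : StrictMonoOn (fun t : ℝ => (φ t).re) (Ioi 0) := by
  have hd : ∀ x : ℝ, 0 < x → HasDerivAt (fun t : ℝ => (φ t).re) (deriv φ x).re x := fun x hx =>
    reCLM.hasFDerivAt.comp_hasDerivAt x (h.hasDerivAt_ofReal hx)
  refine strictMonoOn_of_deriv_pos (convex_Ioi 0)
    (fun x hx => (hd x hx).continuousAt.continuousWithinAt) fun x hx => ?_
  rw [interior_Ioi] at hx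
  rw [(hd x hx).deriv]
  exact h.re_deriv_pos hx

/-! ### Divided differences -/

section dslope

variable {x : ℝ}

theorem dslope_ofReal (h : IsPick φ) (hx : 0 < x) {t : ℝ} (ht : 0 < t) :
    (dslope φ x t).im = 0 ∧ 0 < (dslope φ x t).re := by
  rcases eq_or_ne t x with rfl | hne
  · rw [dslope_same]
    exact ⟨h.im_deriv hx, h.re_deriv_pos hx⟩
  · have hne' : (t : ℂ) ≠ x := by exact_mod_cast hne
    have e : dslope φ x t = (((φ t).re - (φ x).re) / (t - x) : ℝ) := by
      rw [dslope_of_ne _ hne', slope_def_field]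
      push_cast
      congr 1
      exact Complex.ext (by simp) (by simp [h.im_ofReal hx, h.im_ofReal ht])
    rw [e]
    refine ⟨ofReal_im _, ?_⟩
    rw [ofReal_re]
    rcases lt_or_gt_of_ne hne with hlt | hlt
    · exact div_pos_of_neg_of_neg (sub_neg.2 (h.strictMonoOn ht hx hlt)) (sub_neg.2 hlt)
    · exact div_pos (sub_pos.2 (h.strictMonoOn hx ht hlt)) (sub_pos.2 hlt)

theorem im_dslope_mul (h : IsPick φ) (hx : 0 < x) {z : ℂ} (hz : z ∈ upperPlane) :
    0 < (dslope φ x z * (z - x)).im := by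
  have e : dslope φ x z * (z - x) = φ z - φ x := by
    rw [mul_comm]
    exact sub_smul_dslope φ x z
  rw [e, sub_im, h.im_ofReal hx, sub_zero]
  exact h.mapsTo hz

/-- A divided difference that is real and nonpositive would give `φ z - φ x` a nonpositive imaginary
part. Hence its argument is continuous on the upper half-plane. -/
theorem dslope_mem_slitPlane (h : IsPick φ) (hx : 0 < x) {z : ℂ} (hz : z ∈ upperPlane) :
    dslope φ x z ∈ slitPlane := by
  by_contra hc
  rw [mem_slitPlane_iff, not_or, not_lt, not_not] at hc
  have h1 := h.im_dslope_mul hx hz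
  rw [mul_im, hc.2, zero_mul, add_zero, sub_im, ofReal_im, sub_zero] at h1
  exact absurd h1 (not_lt.2 (mul_nonpos_of_nonpos_of_nonneg hc.1 (le_of_lt hz)))

theorem differentiableOn_dslope (h : IsPick φ) (hx : 0 < x) :
    DifferentiableOn ℂ (dslope φ x) slitPlane :=
  (Complex.differentiableOn_dslope (isOpen_slitPlane.mem_nhds (ofReal_mem hx))).2 h.diff

/-- On the ray of argument `π - δ` the divided difference has argument at most `δ`. -/
theorem arg_dslope_le_of_ray (h : IsPick φ) (hx : 0 < x) {δ r : ℝ} (hδ : 0 < δ) (hδ' : δ < Real.pi)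
    (hr : 0 < r) {z : ℂ} (hzr : z = -(r * exp (-(δ * I)))) : arg (dslope φ x z) ≤ δ := by
  have e : z = ((-(r * Real.cos δ) : ℝ) : ℂ) + ((r * Real.sin δ : ℝ) : ℂ) * I := by
    rw [hzr, ← neg_mul (δ : ℂ), ← ofReal_neg, exp_mul_I, ← ofReal_cos, ← ofReal_sin,
      Real.cos_neg, Real.sin_neg]
    push_cast
    ring
  have hre : z.re = -(r * Real.cos δ) := by rw [e]; simp [-ofReal_cos, -ofReal_sin, -ofReal_mul]
  have him : z.im = r * Real.sin δ := by rw [e]; simp [-ofReal_cos, -ofReal_sin, -ofReal_mul]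
  have hz : z ∈ upperPlane := by
    change 0 < z.im
    rw [him]
    exact mul_pos hr (Real.sin_pos_of_pos_of_lt_pi hδ hδ')
  -- With `w` the divided difference and `α = arg w`, `Im (w (z - x)) = -‖w‖ (x sin α + r sin (α -
  -- δ))`. Both sines are positive when `δ < α < π`, contradicting positivity of the left side.
  by_contra! hc
  have h1 := h.im_dslope_mul hx hz
  have hs := h.dslope_mem_slitPlane hx hz
  set w := dslope φ x z
  have hlt : arg w < Real.pi := lt_of_le_of_ne (arg_le_pi w) (mem_slitPlane_iff_arg.1 hs).1
  rw [mul_im, sub_im, sub_re, ofReal_im, ofReal_re, hre, him, ← norm_mul_cos_arg w,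
    ← norm_mul_sin_arg w] at h1
  have s1 : 0 < Real.sin (arg w) := Real.sin_pos_of_pos_of_lt_pi (hδ.trans hc) hlt
  have s2 : 0 < Real.sin (arg w - δ) :=
    Real.sin_pos_of_pos_of_lt_pi (sub_pos.2 hc) (by linarith)
  rw [Real.sin_sub] at s2
  have hn : 0 ≤ ‖w‖ := norm_nonneg w
  have : 0 ≤ ‖w‖ * (x * Real.sin (arg w) +
      r * (Real.sin (arg w) * Real.cos δ - Real.cos (arg w) * Real.sin δ)) := by positivity
  nlinarith

/-- Phragmén–Lindelöf in the sector `0 ≤ arg z ≤ π - δ`: the argument is `0` on the positive axis,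
at most `δ` on the other side, and bounded by `π` throughout. -/
theorem arg_dslope_le (h : IsPick φ) (hx : 0 < x) {δ : ℝ} (hδ : 0 < δ) (hδ' : δ < Real.pi)
    {z : ℂ} (hz : z ∈ upperPlane) (hzδ : arg z ≤ Real.pi - δ) : arg (dslope φ x z) ≤ δ := by
  -- The exponential carries a horizontal strip to the sector, and `E` is chosen so that `‖E‖` is
  -- the exponential of the argument to be bounded.
  set E : ℂ → ℂ := fun w => exp (-(I * log (dslope φ x (exp w))))
  have hE : ∀ w, ‖E w‖ = Real.exp (arg (dslope φ x (exp w))) := by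
    intro w
    rw [norm_exp]
    congr 1
    simp [log_im]
  have him : ∀ w : ℂ, w.im ∈ Icc 0 (Real.pi - δ) → exp w ∈ slitPlane ∧
      dslope φ x (exp w) ∈ slitPlane := by
    intro w hw
    rcases hw.1.eq_or_lt with h0 | h0
    · have e : exp w = ((Real.exp w.re : ℝ) : ℂ) := by
        rw [ofReal_exp]
        congr 1
        exact Complex.ext (by simp) (by simp [← h0])
      rw [e]
      exact ⟨ofReal_mem (Real.exp_pos _), Or.inl (h.dslope_ofReal hx (Real.exp_pos _)).2⟩
    · have : exp w ∈ upperPlane := by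
        change 0 < (exp w).im
        rw [exp_im]
        exact mul_pos (Real.exp_pos _) (Real.sin_pos_of_pos_of_lt_pi h0 (by linarith [hw.2]))
      exact ⟨upperPlane_subset_slitPlane this, h.dslope_mem_slitPlane hx this⟩
  have hdiff : ∀ w : ℂ, w.im ∈ Icc 0 (Real.pi - δ) → DifferentiableAt ℂ E w := by
    intro w hw
    have d1 : DifferentiableAt ℂ (dslope φ x) (exp w) :=
      (h.differentiableOn_dslope hx).differentiableAt (isOpen_slitPlane.mem_nhds (him w hw).1)
    have d2 : DifferentiableAt ℂ (fun w => dslope φ x (exp w)) w :=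
      d1.comp w differentiable_exp.differentiableAt
    exact ((d2.clog (him w hw).2).const_mul I).neg.cexp
  have hz0 : z ≠ 0 := by rintro rfl; simp [upperPlane] at hz
  have key := PhragmenLindelof.horizontal_strip (f := E) (a := 0) (b := Real.pi - δ)
    (C := Real.exp δ) (z := log z) ?_ ?_ ?_ ?_ ?_ ?_
  · rw [hE, exp_log hz0] at key
    exact Real.exp_le_exp.1 key
  · refine ⟨fun w hw => (hdiff w (Ioo_subset_Icc_self hw)).differentiableWithinAt, fun w hw => ?_⟩
    have hw' : w ∈ im ⁻¹' Icc 0 (Real.pi - δ) :=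
      closure_minimal (preimage_mono Ioo_subset_Icc_self) (isClosed_Icc.preimage continuous_im) hw
    exact (hdiff w hw').continuousAt.continuousWithinAt
  -- The modulus of `E` is at most `exp π`, so growth rate `0` suffices.
  · refine ⟨0, by apply div_pos Real.pi_pos; linarith, Real.pi, ?_⟩
    refine Asymptotics.IsBigO.of_bound 1 (Eventually.of_forall fun w => ?_)
    rw [hE, one_mul, zero_mul, Real.exp_zero, mul_one, Real.norm_eq_abs, abs_of_pos
      (Real.exp_pos _)]
    exact Real.exp_le_exp.2 (arg_le_pi _)
  · intro w hw
    have e : exp w = ((Real.exp w.re : ℝ) : ℂ) := by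
      rw [ofReal_exp]
      congr 1
      exact Complex.ext (by simp) (by simp [hw])
    rw [hE, e, arg_eq_zero_iff.2 ⟨(h.dslope_ofReal hx (Real.exp_pos _)).2.le,
      (h.dslope_ofReal hx (Real.exp_pos _)).1⟩]
    exact Real.exp_le_exp.2 hδ.le
  · intro w hw
    rw [hE]
    refine Real.exp_le_exp.2 (h.arg_dslope_le_of_ray hx hδ hδ' (Real.exp_pos w.re) ?_)
    have e : w = (w.re : ℂ) + (Real.pi * I + -(δ * I)) :=
      Complex.ext (by simp) (by simp [hw]; ring)
    conv_lhs => rw [e]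
    rw [exp_add, exp_add, exp_pi_mul_I, ofReal_exp]
    ring
  · rw [log_im]
    exact arg_nonneg_iff.2 (le_of_lt hz)
  · rwa [log_im]

theorem im_dslope_nonpos (h : IsPick φ) (hx : 0 < x) {z : ℂ} (hz : z ∈ upperPlane) :
    (dslope φ x z).im ≤ 0 := by
  have hz' : arg z < Real.pi :=
    lt_of_le_of_ne (arg_le_pi z) (mem_slitPlane_iff_arg.1 (upperPlane_subset_slitPlane hz)).1
  have h0 : arg (dslope φ x z) ≤ 0 := by
    refine le_of_forall_pos_le_add fun ε hε => ?_
    have hzim : 0 ≤ arg z := arg_nonneg_iff.2 (le_of_lt hz)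
    have hm : 0 < min ε ((Real.pi - arg z) / 2) := lt_min hε (by linarith)
    have h1 := min_le_left ε ((Real.pi - arg z) / 2)
    have h2 := min_le_right ε ((Real.pi - arg z) / 2)
    have := h.arg_dslope_le hx hm (by linarith [Real.pi_pos]) hz (by linarith)
    linarith
  by_contra! hc
  have h1 : 0 ≤ arg (dslope φ x z) := arg_nonneg_iff.2 hc.le
  have h2 := (arg_eq_zero_iff.1 (le_antisymm h0 h1)).2
  exact hc.ne' h2

/-- The open mapping theorem makes the weak inequality strict: a nonconstant image is open, and a
constant divided difference would make `φ` affine. -/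
theorem im_dslope_neg (h : IsPick φ) (hna : ¬ ∃ c d : ℂ, ∀ z ∈ upperPlane, φ z = c + d * z)
    (hx : 0 < x) {z : ℂ} (hz : z ∈ upperPlane) : (dslope φ x z).im < 0 := by
  have han : AnalyticOnNhd ℂ (dslope φ x) upperPlane :=
    ((h.differentiableOn_dslope hx).mono upperPlane_subset_slitPlane).analyticOnNhd isOpen_upperPlane
  rcases han.is_constant_or_isOpen isPreconnected_upperPlane with ⟨w, hw⟩ | ho
  · refine absurd ⟨φ x - w * x, w, fun z hz => ?_⟩ hna
    have := sub_smul_dslope φ (x : ℂ) z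
    rw [hw z hz, smul_eq_mul] at this
    linear_combination -this
  · have hop := ho upperPlane Subset.rfl isOpen_upperPlane
    have hsub : dslope φ x '' upperPlane ⊆ {w | w.im ≤ 0} := by
      rintro _ ⟨w, hw, rfl⟩
      exact h.im_dslope_nonpos hx hw
    have hint := interior_maximal hsub hop (mem_image_of_mem _ hz)
    rw [interior_setOfPred_im_le] at hint
    exact hint

/-- Dividing out a real point stays within the class of Pick functions, so monotonicity and
positivity of the derivative become available for the quotient too. -/
theorem neg_dslope (h : IsPick φ) (hna : ¬ ∃ c d : ℂ, ∀ z ∈ upperPlane, φ z = c + d * z)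
    (hx : 0 < x) : IsPick fun z => -dslope φ x z where
  diff := (h.differentiableOn_dslope hx).neg
  mapsTo z hz := by
    change 0 < (-dslope φ x z).im
    rw [neg_im]
    linarith [h.im_dslope_neg hna hx hz]
  map_conj z hz := by
    rw [map_neg, neg_inj]
    rcases eq_or_ne z x with rfl | hne
    · rw [conj_ofReal, dslope_same]
      exact (conj_eq_iff_im.2 (h.im_deriv hx)).symm
    · have hne' : conj z ≠ x := fun h' => hne (by rw [← conj_conj z, h', conj_ofReal])
      rw [dslope_of_ne _ hne, dslope_of_ne _ hne', slope_def_field, slope_def_field, h.map_conj z hz,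
        map_div₀, map_sub, map_sub, conj_ofReal, conj_eq_iff_im.2 (h.im_ofReal hx)]

end dslope

end IsPick

/-! ### Zeros of real combinations of a Pick function, `z` and `1` -/

/-- A function with at most one zero in `S`, and that one simple. -/
theorem sum_analyticOrderAt_le_one {f : ℂ → ℂ} {S : Finset ℂ} (ha : ∀ z ∈ S, AnalyticAt ℂ f z)
    (hu : ∀ z ∈ S, ∀ w ∈ S, f z = 0 → f w = 0 → z = w)
    (hd : ∀ z ∈ S, f z = 0 → deriv f z ≠ 0) : ∑ z ∈ S, analyticOrderAt f z ≤ 1 := by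
  by_cases h : ∃ z ∈ S, f z = 0
  · obtain ⟨z, hz, h0⟩ := h
    rw [Finset.sum_eq_single z]
    · exact ((ha z hz).analyticOrderAt_eq_one_of_zero_deriv_ne_zero h0 (hd z hz h0)).le
    · intro w hw hne
      exact (ha w hw).analyticOrderAt_eq_zero.2 fun h' => hne (hu w hw z hz h' h0)
    · exact fun h' => absurd hz h'
  · push Not at h
    rw [Finset.sum_eq_zero fun z hz => (ha z hz).analyticOrderAt_eq_zero.2 (h z hz)]
    exact zero_le_one

namespace IsPick

variable {φ : ℂ → ℂ} {p q r : ℝ}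

theorem analyticAt (h : IsPick φ) {z : ℂ} (hz : z ∈ slitPlane) : AnalyticAt ℂ φ z :=
  h.diff.analyticAt (isOpen_slitPlane.mem_nhds hz)

theorem hasDerivAt_comb (h : IsPick φ) {z : ℂ} (hz : z ∈ slitPlane) :
    HasDerivAt (fun z => (p : ℂ) * φ z + q * z + r) (p * deriv φ z + q) z := by
  simpa using (((h.hasDerivAt hz).const_mul (p : ℂ)).add
    ((hasDerivAt_id z).const_mul (q : ℂ))).add_const (r : ℂ)

theorem analyticAt_comb (h : IsPick φ) {z : ℂ} (hz : z ∈ slitPlane) :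
    AnalyticAt ℂ (fun z => (p : ℂ) * φ z + q * z + r) z :=
  ((analyticAt_const.mul (h.analyticAt hz)).add (analyticAt_const.mul analyticAt_id)).add
    analyticAt_const

/-- In the presence of a real zero all zeros of `p φ + q z + r` are real. -/
theorem sum_order_of_real_zero (h : IsPick φ)
    (hna : ¬ ∃ c d : ℂ, ∀ z ∈ upperPlane, φ z = c + d * z) (hp : p ≠ 0) {x : ℝ} (hx : 0 < x)
    (h0 : (p : ℂ) * φ x + q * x + r = 0) {S : Finset ℂ} (hS : ∀ z ∈ S, z ∈ slitPlane) :
    ∑ z ∈ S, analyticOrderAt (fun z => (p : ℂ) * φ z + q * z + r) z ≤ 2 := by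
  have hψ := h.neg_dslope hna hx
  -- The combination is `(z - x) g`. Each factor contributes at most one zero; for `g` this uses
  -- that `-dslope φ x` is a Pick function, hence nonreal off the axis and strictly increasing on
  -- it.
  set g : ℂ → ℂ := fun z => (p : ℂ) * dslope φ x z + q with hg
  have hfac : (fun z => (p : ℂ) * φ z + q * z + r) = (fun z => z - (x : ℂ)) * g := by
    funext z
    have := sub_smul_dslope φ (x : ℂ) z
    rw [smul_eq_mul] at this
    simp only [Pi.mul_apply, hg]
    linear_combination -(p : ℂ) * this + h0
  have hga : ∀ z ∈ slitPlane, HasDerivAt g (p * deriv (dslope φ x) z) z := fun z hz =>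
    (((h.differentiableOn_dslope hx).differentiableAt
      (isOpen_slitPlane.mem_nhds hz)).hasDerivAt.const_mul (p : ℂ)).add_const (q : ℂ)
  have hgan : ∀ z ∈ slitPlane, AnalyticAt ℂ g z := fun z hz =>
    (analyticAt_const.mul ((h.differentiableOn_dslope hx).analyticAt
      (isOpen_slitPlane.mem_nhds hz))).add analyticAt_const
  have hid : ∀ z : ℂ, AnalyticAt ℂ (fun z => z - (x : ℂ)) z := fun z =>
    analyticAt_id.sub analyticAt_const
  have him : ∀ z, g z = 0 → (dslope φ x z).im = 0 := by
    intro z hz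
    have := congrArg im hz
    simpa [hg, hp] using this
  have hreal : ∀ z ∈ slitPlane, g z = 0 → ∃ t : ℝ, 0 < t ∧ z = t := by
    intro z hz hgz
    rcases mem_slitPlane_cases hz with hu | hu | hu
    · exact absurd (him z hgz) (h.im_dslope_neg hna hx hu).ne
    · have h1 := hψ.map_conj z hz
      have h2 := congrArg im h1
      simp only [neg_im, map_neg, conj_im, him z hgz, neg_zero, neg_eq_zero] at h2
      exact absurd h2 (h.im_dslope_neg hna hx hu).ne
    · exact hu
  have hsum : ∑ z ∈ S, analyticOrderAt (fun z => (p : ℂ) * φ z + q * z + r) z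
      = ∑ z ∈ S, analyticOrderAt (fun z => z - (x : ℂ)) z + ∑ z ∈ S, analyticOrderAt g z := by
    rw [← Finset.sum_add_distrib]
    refine Finset.sum_congr rfl fun z hz => ?_
    rw [hfac, analyticOrderAt_mul (hid z) (hgan z (hS z hz))]
  rw [hsum, ← one_add_one_eq_two]
  refine add_le_add (sum_analyticOrderAt_le_one (fun z _ => hid z) ?_ ?_)
    (sum_analyticOrderAt_le_one (fun z hz => hgan z (hS z hz)) ?_ ?_)
  · intro z _ w _ hz hw
    rw [sub_eq_zero.1 hz, sub_eq_zero.1 hw]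
  · intro z _ _
    rw [deriv_sub_const, deriv_id'']
    exact one_ne_zero
  · intro z hz w hw hgz hgw
    obtain ⟨t, ht, rfl⟩ := hreal z (hS z hz) hgz
    obtain ⟨u, hu, rfl⟩ := hreal w (hS w hw) hgw
    refine congrArg _ (hψ.strictMonoOn.injOn ht hu ?_)
    have e : (p : ℂ) * dslope φ x t = p * dslope φ x u := by
      simp only [hg] at hgz hgw
      linear_combination hgz - hgw
    simp only [mul_left_cancel₀ (ofReal_ne_zero.2 hp) e]
  · intro z hz hgz
    obtain ⟨t, ht, rfl⟩ := hreal z (hS z hz) hgz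
    rw [(hga _ (hS _ hz)).deriv]
    refine mul_ne_zero (ofReal_ne_zero.2 hp) fun h' => ?_
    have := hψ.re_deriv_pos ht
    rw [deriv.fun_neg, h'] at this
    simp at this

theorem affine_of_fixed (hp : p ≠ 0) (hq : q ≠ 0)
    (hid : EqOn (fun z => -((p : ℂ) * φ z + r) / q) id upperPlane) :
    ∃ c d : ℂ, ∀ z ∈ upperPlane, φ z = c + d * z := by
  refine ⟨-(r / p), -(q / p), fun z hz => ?_⟩
  have hp' : (p : ℂ) ≠ 0 := ofReal_ne_zero.2 hp
  have hq' : (q : ℂ) ≠ 0 := ofReal_ne_zero.2 hq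
  have := hid hz
  simp only [id] at this
  rw [div_eq_iff hq'] at this
  field_simp
  linear_combination -this

/-- Imaginary parts at `a` show that `p` and `q` have opposite signs, so `-(p φ + r) / q` maps the
upper half-plane into itself. Its fixed points are the zeros, and a double zero is a fixed point of
multiplier `1`. Either a second zero or a double one would make this map the identity and `φ`
affine. -/
theorem comb_zero_unique (h : IsPick φ) (hna : ¬ ∃ c d : ℂ, ∀ z ∈ upperPlane, φ z = c + d * z)
    (hp : p ≠ 0) {a : ℂ} (ha : a ∈ upperPlane) (h0 : (p : ℂ) * φ a + q * a + r = 0) :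
    (∀ z ∈ upperPlane, (p : ℂ) * φ z + q * z + r = 0 → z = a) ∧ (p : ℂ) * deriv φ a + q ≠ 0 := by
  have haim : 0 < a.im := ha
  have hφim : 0 < (φ a).im := h.mapsTo ha
  have him : p * (φ a).im + q * a.im = 0 := by simpa using congrArg im h0
  have hq : q ≠ 0 := by
    rintro rfl
    rw [zero_mul, add_zero] at him
    exact (mul_ne_zero hp hφim.ne') him
  have hq' : (q : ℂ) ≠ 0 := ofReal_ne_zero.2 hq
  have hpq : 0 < -(p / q) := by
    have : -(p / q) = a.im / (φ a).im := by
      field_simp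
      linarith
    rw [this]
    positivity
  set g : ℂ → ℂ := fun z => -((p : ℂ) * φ z + r) / q with hg
  have hder : ∀ z ∈ upperPlane, HasDerivAt g (-((p : ℂ) * deriv φ z) / q) z := fun z hz =>
    (((h.hasDerivAt (upperPlane_subset_slitPlane hz)).const_mul (p : ℂ)).add_const
      (r : ℂ)).fun_neg.div_const (q : ℂ)
  have hgd : DifferentiableOn ℂ g upperPlane := fun z hz =>
    (hder z hz).differentiableAt.differentiableWithinAt
  have hgm : MapsTo g upperPlane upperPlane := by
    intro z hz
    have e : g z = ((-(p / q) : ℝ) : ℂ) * φ z + ((-(r / q) : ℝ) : ℂ) := by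
      simp only [hg]
      push_cast
      field_simp
      ring
    change 0 < (g z).im
    rw [e, add_im, ofReal_im, add_zero, im_ofReal_mul]
    exact mul_pos hpq (h.mapsTo hz)
  have hfix : ∀ z, (p : ℂ) * φ z + q * z + r = 0 → g z = z := by
    intro z hz
    simp only [hg]
    rw [div_eq_iff hq']
    linear_combination -hz
  refine ⟨fun z hz hz0 => ?_, fun hd => ?_⟩
  · by_contra hne
    exact hna (affine_of_fixed hp hq (eqOn_id_of_fixed hgd hgm ha (hfix a h0) hz (hfix z hz0) hne))
  · refine hna (affine_of_fixed hp hq (eqOn_id_of_deriv hgd hgm ha (hfix a h0) ?_))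
    rw [(hder a ha).deriv, div_eq_iff hq']
    linear_combination -hd

theorem deriv_conj (h : IsPick φ) {z : ℂ} (hz : z ∈ slitPlane) :
    deriv φ (conj z) = conj (deriv φ z) := by
  have h1 := (h.hasDerivAt (conj_mem hz)).conj_conj
  rw [conj_conj] at h1
  have h2 : HasDerivAt φ (conj (deriv φ (conj z))) z := by
    refine h1.congr_of_eventuallyEq ?_
    filter_upwards [isOpen_slitPlane.mem_nhds hz] with w hw
    simp [h.map_conj w hw]
  rw [h2.deriv, conj_conj]

/-- A nontrivial real combination of `φ`, `z` and `1`, where `φ` is a Pick function on the slit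
plane which is not affine, has there at most two zeros, counted with multiplicity. -/
theorem sum_order_le_two (h : IsPick φ) (hna : ¬ ∃ c d : ℂ, ∀ z ∈ upperPlane, φ z = c + d * z)
    (hpqr : p ≠ 0 ∨ q ≠ 0 ∨ r ≠ 0) {S : Finset ℂ} (hS : ∀ z ∈ S, z ∈ slitPlane) :
    ∑ z ∈ S, analyticOrderAt (fun z => (p : ℂ) * φ z + q * z + r) z ≤ 2 := by
  by_cases hp : p = 0
  · subst hp
    refine le_trans (sum_analyticOrderAt_le_one (fun z hz => h.analyticAt_comb (hS z hz)) ?_ ?_)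
      one_le_two
    · intro z _ w _ hz hw
      by_cases hq : q = 0
      · subst hq
        simp at hz hpqr
        exact absurd hz hpqr
      · refine mul_left_cancel₀ (ofReal_ne_zero.2 hq) ?_
        simp only [ofReal_zero] at hz hw
        linear_combination hz - hw
    · intro z hz h0
      rw [(h.hasDerivAt_comb (hS z hz)).deriv]
      by_cases hq : q = 0
      · subst hq
        simp at h0 hpqr
        exact absurd h0 hpqr
      · simpa using hq
  by_cases hx : ∃ x : ℝ, 0 < x ∧ (p : ℂ) * φ x + q * x + r = 0
  · obtain ⟨x, hx, h0⟩ := hx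
    exact h.sum_order_of_real_zero hna hp hx h0 hS
  push Not at hx
  have hconj : ∀ z ∈ slitPlane, (p : ℂ) * φ z + q * z + r = 0 →
      (p : ℂ) * φ (conj z) + q * conj z + r = 0 := by
    intro z hz h0
    rw [h.map_conj z hz]
    simpa using congrArg conj h0
  -- With no real zeros, the two half-planes contribute at most one zero each.
  rw [← Finset.sum_filter_add_sum_filter_not S (fun z => 0 < z.im), ← one_add_one_eq_two]
  have hlow : ∀ z ∈ S.filter (fun z => ¬ 0 < z.im), (p : ℂ) * φ z + q * z + r = 0 →
      conj z ∈ upperPlane ∧ (p : ℂ) * φ (conj z) + q * conj z + r = 0 := by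
    intro z hz h0
    rw [Finset.mem_filter] at hz
    refine ⟨?_, hconj z (hS z hz.1) h0⟩
    rcases mem_slitPlane_cases (hS z hz.1) with hu | hu | ⟨x, hx0, rfl⟩
    · exact absurd hu hz.2
    · exact hu
    · exact absurd h0 (hx x hx0)
  refine add_le_add
    (sum_analyticOrderAt_le_one (fun z hz => h.analyticAt_comb (hS z (Finset.mem_filter.1 hz).1))
      ?_ ?_)
    (sum_analyticOrderAt_le_one (fun z hz => h.analyticAt_comb (hS z (Finset.mem_filter.1 hz).1))
      ?_ ?_)
  · intro z hz w hw hz0 hw0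
    exact (h.comb_zero_unique hna hp (Finset.mem_filter.1 hw).2 hw0).1 z
      (Finset.mem_filter.1 hz).2 hz0
  · intro z hz hz0
    rw [(h.hasDerivAt_comb (hS z (Finset.mem_filter.1 hz).1)).deriv]
    exact (h.comb_zero_unique hna hp (Finset.mem_filter.1 hz).2 hz0).2
  · intro z hz w hw hz0 hw0
    obtain ⟨hz1, hz2⟩ := hlow z hz hz0
    obtain ⟨hw1, hw2⟩ := hlow w hw hw0
    exact star_injective ((h.comb_zero_unique hna hp hw1 hw2).1 _ hz1 hz2)
  · intro z hz hz0
    obtain ⟨hz1, hz2⟩ := hlow z hz hz0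
    have hzS := hS z (Finset.mem_filter.1 hz).1
    rw [(h.hasDerivAt_comb hzS).deriv]
    intro h'
    refine (h.comb_zero_unique hna hp hz1 hz2).2 ?_
    rw [h.deriv_conj hzS]
    simpa using congrArg conj h'

end IsPick

/-! ### Holomorphic dependence on a parameter -/

/-- Holomorphy of an integral over a compact interval depending on a complex parameter. -/
theorem differentiableOn_intervalIntegral {U : Set ℂ} (hU : IsOpen U) {F F' : ℂ → ℝ → ℂ} (a b : ℝ)
    (hF : ContinuousOn (Function.uncurry F) (U ×ˢ univ))
    (hF' : ContinuousOn (Function.uncurry F') (U ×ˢ univ))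
    (hd : ∀ s ∈ U, ∀ t, HasDerivAt (fun s => F s t) (F' s t) s) :
    DifferentiableOn ℂ (fun s => ∫ t in a..b, F s t) U := by
  intro s hs
  obtain ⟨ε, hε, hball⟩ := nhds_basis_closedBall.mem_iff.1 (hU.mem_nhds hs)
  have hsec : ∀ {G : ℂ → ℝ → ℂ}, ContinuousOn (Function.uncurry G) (U ×ˢ univ) → ∀ z ∈ U,
      Continuous (G z) := fun hG z hz =>
    continuousOn_univ.1 (hG.comp (f := fun t : ℝ => (z, t)) (by fun_prop) fun t _ => ⟨hz, mem_univ _⟩)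
  obtain ⟨C, hC⟩ := ((isCompact_closedBall s ε).prod
    (isCompact_uIcc (a := a) (b := b))).exists_bound_of_continuousOn (hF'.mono (prod_mono hball (subset_univ _)))
  have := intervalIntegral.hasDerivAt_integral_of_dominated_loc_of_deriv_le (μ := volume)
    (F := F) (F' := F') (x₀ := s) (a := a) (b := b) (bound := fun _ => C)
    (s := closedBall s ε) (closedBall_mem_nhds s hε)
    (by
      filter_upwards [hU.mem_nhds hs] with z hz
      exact (hsec hF z hz).aestronglyMeasurable)
    ((hsec hF s hs).intervalIntegrable _ _) (hsec hF' s hs).aestronglyMeasurable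
    (Eventually.of_forall fun t ht z hz => hC (z, t) ⟨hz, uIoc_subset_uIcc ht⟩)
    intervalIntegrable_const
    (Eventually.of_forall fun t _ z hz => hd z (hball hz) t)
  exact this.2.differentiableAt.differentiableWithinAt

end Pick

/-! ### The elliptic moments as functions of `s` -/

namespace Duffing

open Pick

/-- With `x = √(1 + s) sin θ` and `s = √(1 + 4h)`, one has
`y² = (1 + s) cos² θ · radicand s θ / 2` on the level curve `{H = h}`. -/
noncomputable def radicand (s : ℂ) (θ : ℝ) : ℂ :=
  (1 + s) * ((Real.sin θ ^ 2 : ℝ) : ℂ) + (s - 1)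

/-- The branch of `(radicand s θ) ^ (-1 / 2)` which is positive for `s > 1`. -/
noncomputable def kernel (s : ℂ) (θ : ℝ) : ℂ := exp (-(log (radicand s θ) / 2))

/-- The values of `√(1 + 4h)` for `h` in the slit plane. -/
def rootDomain : Set ℂ := {s | 0 < s.re} ∩ {s | s - 1 ∈ slitPlane}

theorem isOpen_rootDomain : IsOpen rootDomain :=
  (isOpen_lt continuous_const continuous_re).inter
    (isOpen_slitPlane.preimage (continuous_id.sub continuous_const))

theorem radicand_re (s : ℂ) (θ : ℝ) :
    (radicand s θ).re = (1 + s.re) * Real.sin θ ^ 2 + (s.re - 1) := by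
  simp only [radicand, add_re, re_mul_ofReal, one_re, sub_re]

theorem radicand_im (s : ℂ) (θ : ℝ) : (radicand s θ).im = s.im * (1 + Real.sin θ ^ 2) := by
  simp only [radicand, add_im, im_mul_ofReal, one_im, sub_im]
  ring

theorem radicand_mem {s : ℂ} (hs : s ∈ rootDomain) (θ : ℝ) : radicand s θ ∈ slitPlane := by
  obtain ⟨h1, h2⟩ := hs
  have h0 : (0 : ℝ) < s.re := h1
  rw [mem_ofPred_eq, mem_slitPlane_iff, sub_re, sub_im, one_re, one_im, sub_zero] at h2
  rw [mem_slitPlane_iff, radicand_re, radicand_im]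
  rcases h2 with h | h
  · left; positivity
  · right
    have : 0 < 1 + Real.sin θ ^ 2 := by positivity
    exact mul_ne_zero h this.ne'

theorem continuousOn_radicand (U : Set (ℂ × ℝ)) :
    ContinuousOn (fun p : ℂ × ℝ => radicand p.1 p.2) U := by
  unfold radicand
  fun_prop

theorem continuousOn_kernel :
    ContinuousOn (fun p : ℂ × ℝ => kernel p.1 p.2) (rootDomain ×ˢ univ) :=
  (((continuousOn_radicand _).clog fun p hp => radicand_mem hp.1 p.2).div_const 2).neg.cexp

theorem continuous_kernel {s : ℂ} (hs : s ∈ rootDomain) : Continuous (kernel s) :=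
  continuousOn_univ.1 (continuousOn_kernel.comp (f := fun t : ℝ => (s, t)) (by fun_prop)
    fun _ _ => ⟨hs, mem_univ _⟩)

theorem hasDerivAt_kernel {s : ℂ} (hs : s ∈ rootDomain) (θ : ℝ) :
    HasDerivAt (fun s => kernel s θ)
      (kernel s θ * -((1 + ((Real.sin θ ^ 2 : ℝ) : ℂ)) / radicand s θ / 2)) s := by
  have h1 : HasDerivAt (fun s => radicand s θ) (1 + ((Real.sin θ ^ 2 : ℝ) : ℂ)) s := by
    have := (((hasDerivAt_id s).const_add 1).mul_const ((Real.sin θ ^ 2 : ℝ) : ℂ)).add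
      ((hasDerivAt_id s).sub_const 1)
    refine this.congr_deriv ?_
    ring
  exact ((h1.clog (radicand_mem hs θ)).div_const 2).fun_neg.cexp

/-- The moments `∫ sinⁿ θ · kernel s θ dθ` over `[-π/2, π/2]`. -/
noncomputable def moment (n : ℕ) (s : ℂ) : ℂ :=
  ∫ θ in (-(Real.pi / 2))..(Real.pi / 2), ((Real.sin θ ^ n : ℝ) : ℂ) * kernel s θ

theorem differentiableOn_moment (n : ℕ) : DifferentiableOn ℂ (moment n) rootDomain := by
  have hk := continuousOn_kernel
  refine differentiableOn_intervalIntegral isOpen_rootDomain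
    (F' := fun s θ => ((Real.sin θ ^ n : ℝ) : ℂ) *
      (kernel s θ * -((1 + ((Real.sin θ ^ 2 : ℝ) : ℂ)) / radicand s θ / 2))) _ _ ?_ ?_ ?_
  · exact ContinuousOn.mul (by fun_prop) hk
  · refine ContinuousOn.mul (by fun_prop) (hk.mul (ContinuousOn.neg (ContinuousOn.div_const
      (ContinuousOn.div (by fun_prop) (continuousOn_radicand _) ?_) 2)))
    exact fun p hp => slitPlane_ne_zero (radicand_mem hp.1 p.2)
  · exact fun s hs θ => (hasDerivAt_kernel hs θ).const_mul _

theorem conj_mem_rootDomain {s : ℂ} (hs : s ∈ rootDomain) : conj s ∈ rootDomain := by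
  refine ⟨by simpa using hs.1, ?_⟩
  have := conj_mem hs.2
  simpa using this

theorem kernel_conj {s : ℂ} (hs : s ∈ rootDomain) (θ : ℝ) :
    kernel (conj s) θ = conj (kernel s θ) := by
  have e : radicand (conj s) θ = conj (radicand s θ) := by
    simp only [radicand, map_add, map_mul, map_sub, map_one, conj_ofReal]
  rw [kernel, e, log_conj _ (mem_slitPlane_iff_arg.1 (radicand_mem hs θ)).1, kernel, ← exp_conj, map_neg,
    map_div₀, map_ofNat]

theorem moment_conj {s : ℂ} (hs : s ∈ rootDomain) (n : ℕ) :
    moment n (conj s) = conj (moment n s) := by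
  rw [moment, moment, ← intervalIntegral.intervalIntegral_conj]
  refine intervalIntegral.integral_congr fun θ _ => ?_
  simp only [kernel_conj hs, map_mul, conj_ofReal]

/-! ### Positivity -/

theorem arg_lt_arg {z w : ℂ} (hz : z ∈ upperPlane) (hw : w ∈ upperPlane) (h : 0 < (w * conj z).im) :
    arg z < arg w := by
  have hz' : z ≠ 0 := by rintro rfl; simp [upperPlane] at hz
  have hw' : w ≠ 0 := by rintro rfl; simp [upperPlane] at hw
  by_contra! hle
  have h1 : arg z ≤ Real.pi := arg_le_pi z
  have h2 : 0 ≤ arg w := arg_nonneg_iff.2 (le_of_lt hw)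
  have h3 : 0 ≤ Real.sin (arg z - arg w) :=
    Real.sin_nonneg_of_nonneg_of_le_pi (by linarith) (by linarith)
  have e : (w * conj z).im = -(‖z‖ * ‖w‖ * Real.sin (arg z - arg w)) := by
    rw [Real.sin_sub, mul_im, conj_re, conj_im, ← norm_mul_cos_arg z, ← norm_mul_sin_arg z,
      ← norm_mul_cos_arg w, ← norm_mul_sin_arg w]
    ring
  rw [e] at h
  have : 0 ≤ ‖z‖ * ‖w‖ * Real.sin (arg z - arg w) := by positivity
  linarith

/-- The condition `x < β / 2` keeps `β - x` in `(0, π)`, and writing `t = u + (t - u)` turns the sum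
into `2 u sin β cos x + (t - u) sin (β - x)`. -/
theorem sin_comb_pos {β x t u : ℝ} (hβ : 0 < β) (hβ' : β < Real.pi) (hx : 0 < x) (hx' : x < β / 2)
    (hu : 0 ≤ u) (hut : u < t) : 0 < Real.sin (β + x) * u + Real.sin (β - x) * t := by
  have h1 : 0 < Real.sin (β - x) := Real.sin_pos_of_pos_of_lt_pi (by linarith) (by linarith)
  have h2 : 0 < Real.sin β := Real.sin_pos_of_pos_of_lt_pi hβ hβ'
  have h3 : 0 < Real.cos x := Real.cos_pos_of_mem_Ioo ⟨by linarith, by linarith⟩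
  have e : Real.sin (β + x) * u + Real.sin (β - x) * t =
      u * (2 * (Real.sin β * Real.cos x)) + (t - u) * Real.sin (β - x) := by
    rw [Real.sin_add, Real.sin_sub]; ring
  rw [e]
  have := sub_pos.2 hut
  positivity

section positivity

variable {s : ℂ}

theorem mem_rootDomain_of_upperPlane (hre : 0 < s.re) (hs : s ∈ upperPlane) : s ∈ rootDomain :=
  ⟨hre, upperPlane_subset_slitPlane (by simpa [upperPlane] using hs)⟩

theorem radicand_mem_upperPlane (hs : s ∈ upperPlane) (θ : ℝ) : radicand s θ ∈ upperPlane := by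
  change 0 < (radicand s θ).im
  rw [radicand_im]
  exact mul_pos hs (by positivity)

/-- The radicand runs along the segment from `s - 1` to `2 s` as `sin² θ` goes from `0` to `1`, and
its argument decreases on the way. -/
theorem arg_radicand_lt (hs : s ∈ upperPlane) {θ η : ℝ} (h : Real.sin η ^ 2 < Real.sin θ ^ 2) :
    arg (radicand s θ) < arg (radicand s η) := by
  refine arg_lt_arg (radicand_mem_upperPlane hs θ) (radicand_mem_upperPlane hs η) ?_
  have hs' : 0 < s.im := hs
  rw [mul_im, conj_re, conj_im, radicand_re, radicand_re, radicand_im, radicand_im]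
  nlinarith [mul_pos hs' (sub_pos.2 h)]

theorem radicand_zero (s : ℂ) : radicand s 0 = s - 1 := by simp [radicand]

theorem kernel_eq (s : ℂ) (θ : ℝ) :
    kernel s θ = Real.exp (-(Real.log ‖radicand s θ‖ / 2)) *
      exp (((-(arg (radicand s θ) / 2) : ℝ) : ℂ) * I) := by
  rw [kernel, log, ofReal_exp, ← exp_add]
  congr 1
  push_cast
  ring

theorem im_sub_one_mul_kernel (s : ℂ) (θ η : ℝ) :
    ((s - 1) * (kernel s θ * conj (kernel s η))).im =
      ‖s - 1‖ * (Real.exp (-(Real.log ‖radicand s θ‖ / 2)) *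
        Real.exp (-(Real.log ‖radicand s η‖ / 2))) *
        Real.sin (arg (s - 1) + (arg (radicand s η) - arg (radicand s θ)) / 2) := by
  set n := Real.exp (-(Real.log ‖radicand s θ‖ / 2))
  set m := Real.exp (-(Real.log ‖radicand s η‖ / 2))
  have e : (s - 1) * (kernel s θ * conj (kernel s η)) = ((‖s - 1‖ * (n * m) : ℝ) : ℂ) *
      exp (((arg (s - 1) + (arg (radicand s η) - arg (radicand s θ)) / 2 : ℝ) : ℂ) * I) := by
    conv_lhs => rw [← norm_mul_exp_arg_mul_I (s - 1), kernel_eq, kernel_eq]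
    rw [map_mul, ← exp_conj, map_mul, conj_ofReal, conj_ofReal, conj_I]
    have : exp (((arg (s - 1) + (arg (radicand s η) - arg (radicand s θ)) / 2 : ℝ) : ℂ) * I) =
        exp (arg (s - 1) * I) * (exp (((-(arg (radicand s θ) / 2) : ℝ) : ℂ) * I) *
          exp (((-(arg (radicand s η) / 2) : ℝ) : ℂ) * -I)) := by
      rw [← exp_add, ← exp_add]
      congr 1
      push_cast
      ring
    rw [this]
    simp only [n, m]
    push_cast
    ring
  rw [e, im_ofReal_mul, exp_ofReal_mul_I_im]

/-- The symmetrised integrand of `(s - 1) · moment 0 · conj (moment 2)`. -/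
noncomputable def pairKernel (s : ℂ) (θ η : ℝ) : ℝ :=
  ((s - 1) * (kernel s θ * conj (kernel s η))).im * Real.sin η ^ 2 +
    ((s - 1) * (kernel s η * conj (kernel s θ))).im * Real.sin θ ^ 2

theorem pairKernel_comm (s : ℂ) (θ η : ℝ) : pairKernel s θ η = pairKernel s η θ := add_comm _ _

theorem arg_sub_one_mem (hs : s ∈ upperPlane) : 0 < arg (s - 1) ∧ arg (s - 1) < Real.pi := by
  have h : s - 1 ∈ upperPlane := by simpa [upperPlane] using hs
  have h2 := mem_slitPlane_iff_arg.1 (upperPlane_subset_slitPlane h)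
  refine ⟨lt_of_le_of_ne (arg_nonneg_iff.2 (le_of_lt h)) fun h0 => ?_,
    lt_of_le_of_ne (arg_le_pi _) h2.1⟩
  exact (ne_of_gt h) (arg_eq_zero_iff.1 h0.symm).2

/-- Up to a positive factor this is `sin_comb_pos` with `β = arg (s - 1)` and `x` half the
difference of the arguments of the two radicands. Both arguments lie in `(0, β]`, so `x < β / 2`. -/
theorem pairKernel_pos_of_lt (hs : s ∈ upperPlane) {θ η : ℝ} (h : Real.sin η ^ 2 < Real.sin θ ^ 2) :
    0 < pairKernel s θ η := by
  obtain ⟨hβ, hβ'⟩ := arg_sub_one_mem hs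
  have h1 := arg_radicand_lt hs h
  have h0 : 0 ≤ arg (radicand s θ) := arg_nonneg_iff.2 (le_of_lt (radicand_mem_upperPlane hs θ))
  have h00 : arg (radicand s θ) ≠ 0 := fun h' =>
    (ne_of_gt (radicand_mem_upperPlane hs θ)) (arg_eq_zero_iff.1 h').2
  have hpos := lt_of_le_of_ne h0 h00.symm
  have h2 : arg (radicand s η) ≤ arg (s - 1) := by
    rw [← radicand_zero]
    rcases (sq_nonneg (Real.sin η)).eq_or_lt with h' | h'
    · rw [radicand, radicand, ← h']; simp
    · exact (arg_radicand_lt hs (by simpa using h')).le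
  have hn : s - 1 ≠ 0 := fun h' => by rw [h'] at hβ; simp at hβ
  have key := sin_comb_pos (x := (arg (radicand s η) - arg (radicand s θ)) / 2) hβ hβ'
    (by linarith) (by linarith) (sq_nonneg (Real.sin η)) h
  have e : arg (s - 1) - (arg (radicand s η) - arg (radicand s θ)) / 2 =
    arg (s - 1) + (arg (radicand s θ) - arg (radicand s η)) / 2 := by ring
  rw [e] at key
  rw [pairKernel, im_sub_one_mul_kernel, im_sub_one_mul_kernel]
  have : 0 < ‖s - 1‖ * (Real.exp (-(Real.log ‖radicand s θ‖ / 2)) *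
        Real.exp (-(Real.log ‖radicand s η‖ / 2))) := by
    have := norm_pos_iff.2 hn
    positivity
  nlinarith [mul_pos this key]

theorem pairKernel_pos (hs : s ∈ upperPlane) {θ η : ℝ} (h : Real.sin η ^ 2 ≠ Real.sin θ ^ 2) :
    0 < pairKernel s θ η := by
  rcases lt_or_gt_of_ne h with h | h
  · exact pairKernel_pos_of_lt hs h
  · rw [pairKernel_comm]
    exact pairKernel_pos_of_lt hs h

theorem pairKernel_nonneg (hs : s ∈ upperPlane) (θ η : ℝ) : 0 ≤ pairKernel s θ η := by
  by_cases h : Real.sin η ^ 2 = Real.sin θ ^ 2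
  · have hr : radicand s η = radicand s θ := by rw [radicand, radicand, h]
    have hs' : 0 < s.im := hs
    have hk : kernel s η = kernel s θ := by rw [kernel, kernel, hr]
    rw [pairKernel, hk, mul_conj, im_mul_ofReal, sub_im, one_im, sub_zero]
    have := normSq_nonneg (kernel s θ)
    positivity
  · exact (pairKernel_pos hs h).le

theorem continuous_pairKernel (hs : s ∈ rootDomain) (θ : ℝ) : Continuous (pairKernel s θ) := by
  have hk := continuous_kernel hs
  have hc : Continuous fun η => conj (kernel s η) := continuous_conj.comp hk
  unfold pairKernel
  fun_prop

theorem integral_pairKernel (hs : s ∈ rootDomain) (θ : ℝ) :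
    ∫ η in (-(Real.pi / 2))..(Real.pi / 2), pairKernel s θ η =
      ((s - 1) * (kernel s θ * conj (moment 2 s) +
        ((Real.sin θ ^ 2 : ℝ) : ℂ) * conj (kernel s θ) * moment 0 s)).im := by
  have hk := continuous_kernel hs
  have hc : Continuous fun η => conj (kernel s η) := continuous_conj.comp hk
  have e : ∀ η, pairKernel s θ η = imCLM ((s - 1) * (kernel s θ *
      conj (((Real.sin η ^ 2 : ℝ) : ℂ) * kernel s η) + ((Real.sin θ ^ 2 : ℝ) : ℂ) *
        conj (kernel s θ) * (((Real.sin η ^ 0 : ℝ) : ℂ) * kernel s η))) := by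
    intro η
    rw [imCLM_apply, pairKernel, ← im_mul_ofReal, ← im_mul_ofReal, ← add_im]
    congr 1
    rw [map_mul, conj_ofReal]
    push_cast
    ring
  have c1 : Continuous fun η => conj (((Real.sin η ^ 2 : ℝ) : ℂ) * kernel s η) :=
    continuous_conj.comp (by fun_prop)
  have c2 : Continuous fun η => ((Real.sin η ^ 0 : ℝ) : ℂ) * kernel s η := by fun_prop
  simp only [e]
  rw [imCLM.intervalIntegral_comp_comm (Continuous.intervalIntegrable (by fun_prop) _ _),
    imCLM_apply, intervalIntegral.integral_const_mul, intervalIntegral.integral_add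
      (Continuous.intervalIntegrable (by fun_prop) _ _)
      (Continuous.intervalIntegrable (by fun_prop) _ _),
    intervalIntegral.integral_const_mul, intervalIntegral.integral_const_mul,
    intervalIntegral.intervalIntegral_conj]
  rfl

/-- The two terms of `pairKernel` are exchanged by swapping the variables, so each contributes the
same amount; hence the factor `2`. -/
theorem integral_integral_pairKernel (hs : s ∈ rootDomain) :
    ∫ θ in (-(Real.pi / 2))..(Real.pi / 2), ∫ η in (-(Real.pi / 2))..(Real.pi / 2),
      pairKernel s θ η = 2 * ((s - 1) * moment 0 s * conj (moment 2 s)).im := by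
  have hk := continuous_kernel hs
  have e : ∀ θ, ((s - 1) * (kernel s θ * conj (moment 2 s) +
      ((Real.sin θ ^ 2 : ℝ) : ℂ) * conj (kernel s θ) * moment 0 s)).im =
      imCLM ((s - 1) * (conj (moment 2 s) * (((Real.sin θ ^ 0 : ℝ) : ℂ) * kernel s θ) +
        moment 0 s * conj (((Real.sin θ ^ 2 : ℝ) : ℂ) * kernel s θ))) := by
    intro θ
    rw [imCLM_apply]
    congr 1
    rw [map_mul, conj_ofReal]
    push_cast
    ring
  have c1 : Continuous fun η => conj (((Real.sin η ^ 2 : ℝ) : ℂ) * kernel s η) :=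
    continuous_conj.comp (by fun_prop)
  have c2 : Continuous fun η => ((Real.sin η ^ 0 : ℝ) : ℂ) * kernel s η := by fun_prop
  simp only [integral_pairKernel hs, e]
  rw [imCLM.intervalIntegral_comp_comm (Continuous.intervalIntegrable (by fun_prop) _ _),
    imCLM_apply, intervalIntegral.integral_const_mul, intervalIntegral.integral_add
      (Continuous.intervalIntegrable (by fun_prop) _ _)
      (Continuous.intervalIntegrable (by fun_prop) _ _),
    intervalIntegral.integral_const_mul, intervalIntegral.integral_const_mul,
    intervalIntegral.intervalIntegral_conj]
  change ((s - 1) * (conj (moment 2 s) * moment 0 s + moment 0 s * conj (moment 2 s))).im = _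
  rw [show (s - 1) * (conj (moment 2 s) * moment 0 s + moment 0 s * conj (moment 2 s)) =
    ((2 : ℝ) : ℂ) * ((s - 1) * moment 0 s * conj (moment 2 s)) by push_cast; ring, im_ofReal_mul]

theorem im_moment_pos (hre : 0 < s.re) (hs : s ∈ upperPlane) :
    0 < ((s - 1) * moment 0 s * conj (moment 2 s)).im := by
  have hsd := mem_rootDomain_of_upperPlane hre hs
  have hpi := Real.pi_pos
  have hlt : -(Real.pi / 2) < Real.pi / 2 := by linarith
  have hin : ∀ θ, 0 < ∫ η in (-(Real.pi / 2))..(Real.pi / 2), pairKernel s θ η := by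
    intro θ
    refine intervalIntegral.integral_pos hlt (continuous_pairKernel hsd θ).continuousOn
      (fun η _ => pairKernel_nonneg hs θ η) ?_
    -- Strict positivity needs an `η` with `sin² η ≠ sin² θ`; one of `0` and `π / 2` always serves.
    by_cases h : Real.sin θ ^ 2 = 0
    · exact ⟨Real.pi / 2, ⟨hlt.le, le_rfl⟩, pairKernel_pos hs (by rw [h]; simp)⟩
    · exact ⟨0, ⟨by linarith, by linarith⟩, pairKernel_pos hs (by simpa using Ne.symm h)⟩
  have hk := continuous_kernel hsd
  have hc : Continuous fun η => conj (kernel s η) := continuous_conj.comp hk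
  have hout := intervalIntegral.intervalIntegral_pos_of_pos_on
    (f := fun θ => ∫ η in (-(Real.pi / 2))..(Real.pi / 2), pairKernel s θ η)
    (by
      simp only [integral_pairKernel hsd]
      exact Continuous.intervalIntegrable (by fun_prop) _ _)
    (fun θ _ => hin θ) hlt
  rw [integral_integral_pairKernel hsd] at hout
  linarith

end positivity

/-! ### Real arguments -/

section real

variable {s : ℝ}

/-- The radicand for real arguments. -/
noncomputable def realRadicand (s θ : ℝ) : ℝ := (1 + s) * Real.sin θ ^ 2 + (s - 1)

/-- The moments for real arguments. -/
noncomputable def realMoment (n : ℕ) (s : ℝ) : ℝ :=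
  ∫ θ in (-(Real.pi / 2))..(Real.pi / 2), Real.sin θ ^ n * (√(realRadicand s θ))⁻¹

theorem realRadicand_pos (hs : 1 < s) (θ : ℝ) : 0 < realRadicand s θ := by
  have : 0 < s - 1 := sub_pos.2 hs
  have : 0 < 1 + s := by linarith
  unfold realRadicand
  positivity

theorem continuous_realRadicand (s : ℝ) : Continuous (realRadicand s) := by
  unfold realRadicand
  fun_prop

theorem continuous_inv_sqrt_realRadicand (hs : 1 < s) :
    Continuous fun θ => (√(realRadicand s θ))⁻¹ :=
  (continuous_realRadicand s).sqrt.inv₀ fun θ => (Real.sqrt_pos.2 (realRadicand_pos hs θ)).ne'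

theorem kernel_ofReal (hs : 1 < s) (θ : ℝ) :
    kernel (s : ℂ) θ = (((√(realRadicand s θ))⁻¹ : ℝ) : ℂ) := by
  have hp := realRadicand_pos hs θ
  have e : radicand (s : ℂ) θ = ((realRadicand s θ : ℝ) : ℂ) := by
    simp only [radicand, realRadicand]
    push_cast
    ring
  have h2 : Real.exp (-(Real.log (realRadicand s θ) / 2)) = (√(realRadicand s θ))⁻¹ := by
    rw [Real.exp_neg, Real.exp_half, Real.exp_log hp]
  rw [kernel, e, ← ofReal_log hp.le, ← h2, ofReal_exp]
  push_cast
  rfl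

theorem moment_ofReal (hs : 1 < s) (n : ℕ) : moment n (s : ℂ) = (realMoment n s : ℂ) := by
  rw [moment, realMoment, ← intervalIntegral.integral_ofReal]
  refine intervalIntegral.integral_congr fun θ _ => ?_
  simp only [kernel_ofReal hs]
  push_cast
  ring

/-- The radicand lies between `s - 1` and `2 s`, and `2 s ≤ 4 (s - 1)` for `s ≥ 2`. The comparison
of the two moments bounds the growth of `ratio` at infinity. -/
theorem realMoment_bounds (hs : 2 ≤ s) :
    0 ≤ realMoment 0 s ∧ realMoment 0 s ≤ 4 * realMoment 2 s := by
  have hs1 : 1 < s := by linarith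
  have hpi := Real.pi_pos
  have hle : -(Real.pi / 2) ≤ Real.pi / 2 := by linarith
  have hc := continuous_inv_sqrt_realRadicand hs1
  have hr : 0 < √(s - 1) := Real.sqrt_pos.2 (by linarith)
  have e4 : √(4 * (s - 1)) = 2 * √(s - 1) := by
    rw [Real.sqrt_mul (by norm_num), show (4 : ℝ) = 2 ^ 2 by norm_num, Real.sqrt_sq (by norm_num)]
  refine ⟨intervalIntegral.integral_nonneg hle fun θ _ => by positivity, ?_⟩
  have h0 : realMoment 0 s ≤ Real.pi * (√(s - 1))⁻¹ := by
    have : realMoment 0 s ≤ ∫ _ in (-(Real.pi / 2))..(Real.pi / 2), (√(s - 1))⁻¹ := by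
      refine intervalIntegral.integral_mono_on hle
        (Continuous.intervalIntegrable (by fun_prop) _ _) intervalIntegrable_const fun θ _ => ?_
      rw [pow_zero, one_mul]
      refine inv_anti₀ hr (Real.sqrt_le_sqrt ?_)
      rw [realRadicand]
      have : 0 ≤ (1 + s) * Real.sin θ ^ 2 := by positivity
      linarith
    refine this.trans_eq ?_
    rw [intervalIntegral.integral_const, smul_eq_mul]
    ring
  have h2 : Real.pi / 2 * (2 * √(s - 1))⁻¹ ≤ realMoment 2 s := by
    have : ∫ θ in (-(Real.pi / 2))..(Real.pi / 2), Real.sin θ ^ 2 * (2 * √(s - 1))⁻¹ ≤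
        realMoment 2 s := by
      refine intervalIntegral.integral_mono_on hle
        (Continuous.intervalIntegrable (by fun_prop) _ _)
        (Continuous.intervalIntegrable (by fun_prop) _ _) fun θ _ => ?_
      refine mul_le_mul_of_nonneg_left ?_ (sq_nonneg _)
      rw [← e4]
      refine inv_anti₀ (Real.sqrt_pos.2 (realRadicand_pos hs1 θ)) (Real.sqrt_le_sqrt ?_)
      rw [realRadicand]
      have : (1 + s) * Real.sin θ ^ 2 ≤ (1 + s) * 1 :=
        mul_le_mul_of_nonneg_left (Real.sin_sq_le_one θ) (by linarith)
      linarith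
    refine le_trans (le_of_eq ?_) this
    rw [intervalIntegral.integral_mul_const, integral_sin_sq]
    simp
  have : Real.pi * (√(s - 1))⁻¹ = 4 * (Real.pi / 2 * (2 * √(s - 1))⁻¹) := by
    field_simp
    ring
  linarith

theorem realMoment_two_pos (hs : 1 < s) : 0 < realMoment 2 s := by
  have hpi := Real.pi_pos
  have hlt : -(Real.pi / 2) < Real.pi / 2 := by linarith
  have hc := continuous_inv_sqrt_realRadicand hs
  refine intervalIntegral.integral_pos hlt (Continuous.continuousOn (by fun_prop))
    (fun θ _ => by positivity) ⟨Real.pi / 2, ⟨hlt.le, le_rfl⟩, ?_⟩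
  have := Real.sqrt_pos.2 (realRadicand_pos hs (Real.pi / 2))
  rw [Real.sin_pi_div_two]
  positivity

/-! ### Reduction of the oval integrals to moments -/

/-- The integrals `∫ sinⁿ θ cos² θ √(realRadicand s θ) dθ`, to which `ovalIntegral` reduces. -/
noncomputable def areaMoment (n : ℕ) (s : ℝ) : ℝ :=
  ∫ θ in (-(Real.pi / 2))..(Real.pi / 2), Real.sin θ ^ n * Real.cos θ ^ 2 * √(realRadicand s θ)

theorem hasDerivAt_sqrt_realRadicand (hs : 1 < s) (θ : ℝ) :
    HasDerivAt (fun θ => √(realRadicand s θ))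
      ((1 + s) * (Real.sin θ * Real.cos θ) * (√(realRadicand s θ))⁻¹) θ := by
  have h1 : HasDerivAt (realRadicand s) ((1 + s) * (2 * Real.sin θ * Real.cos θ)) θ := by
    have := (((Real.hasDerivAt_sin θ).pow 2).const_mul (1 + s)).add_const (s - 1)
    refine this.congr_deriv ?_
    push_cast
    ring
  refine (h1.sqrt (realRadicand_pos hs θ).ne').congr_deriv ?_
  have := Real.sqrt_pos.2 (realRadicand_pos hs θ)
  field_simp

theorem integral_eq_zero_of_boundary {G g : ℝ → ℝ} (hG : ∀ θ, HasDerivAt G (g θ) θ)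
    (hg : Continuous g) (h1 : G (Real.pi / 2) = 0) (h2 : G (-(Real.pi / 2)) = 0) :
    ∫ θ in (-(Real.pi / 2))..(Real.pi / 2), g θ = 0 := by
  rw [intervalIntegral.integral_eq_sub_of_hasDerivAt (fun θ _ => hG θ) (hg.intervalIntegrable _ _),
    h1, h2, sub_zero]

/-- Integrate the derivative of `sin θ cos θ √R`, where `R = realRadicand s θ`; the boundary terms
vanish with `cos`. -/
theorem areaMoment_zero (hs : 1 < s) :
    3 * areaMoment 0 s = 2 * ((s - 1) * realMoment 0 s + realMoment 2 s) := by
  have hc := continuous_inv_sqrt_realRadicand hs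
  have hr := (continuous_realRadicand s).sqrt
  have h0 := integral_eq_zero_of_boundary
    (G := fun θ => Real.sin θ * Real.cos θ * √(realRadicand s θ))
    (g := fun θ => 3 * (Real.sin θ ^ 0 * Real.cos θ ^ 2 * √(realRadicand s θ)) -
      2 * ((s - 1) * (Real.sin θ ^ 0 * (√(realRadicand s θ))⁻¹) +
        Real.sin θ ^ 2 * (√(realRadicand s θ))⁻¹)) ?_ (by fun_prop) (by simp) (by simp)
  · rw [intervalIntegral.integral_sub (Continuous.intervalIntegrable (by fun_prop) _ _)
      (Continuous.intervalIntegrable (by fun_prop) _ _), intervalIntegral.integral_const_mul,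
      intervalIntegral.integral_const_mul,
      intervalIntegral.integral_add (Continuous.intervalIntegrable (by fun_prop) _ _)
      (Continuous.intervalIntegrable (by fun_prop) _ _), intervalIntegral.integral_const_mul] at h0
    exact sub_eq_zero.1 h0
  · intro θ
    refine (((Real.hasDerivAt_sin θ).mul (Real.hasDerivAt_cos θ)).mul
      (hasDerivAt_sqrt_realRadicand hs θ)).congr_deriv ?_
    have hp := Real.sqrt_pos.2 (realRadicand_pos hs θ)
    have hsq := Real.sq_sqrt (realRadicand_pos hs θ).le
    have hcos := Real.cos_sq' θ
    simp only [Pi.mul_apply]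
    set w := √(realRadicand s θ)
    field_simp
    rw [hsq, realRadicand]
    set u := Real.sin θ
    set v := Real.cos θ
    linear_combination (- 2 * ((1 + s) * u ^ 2 + (s - 1)) + (1 + s) * u ^ 2) * hcos

/-- Integrate the derivative of `((1 + s) sin³ θ - sin θ) cos θ √R`, where `R = realRadicand s θ`.
This combination eliminates `realMoment 0` except through `areaMoment 0`, and leaves the coefficient
`s²`, which is affine in `h`. -/
theorem areaMoment_two (hs : 1 < s) :
    5 * (1 + s) * areaMoment 2 s = 2 * s ^ 2 * realMoment 2 s + areaMoment 0 s := by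
  have hc := continuous_inv_sqrt_realRadicand hs
  have hr := (continuous_realRadicand s).sqrt
  have h0 := integral_eq_zero_of_boundary
    (G := fun θ => (1 + s) * (Real.sin θ ^ 3 * Real.cos θ * √(realRadicand s θ)) -
      Real.sin θ * Real.cos θ * √(realRadicand s θ))
    (g := fun θ => 5 * (1 + s) * (Real.sin θ ^ 2 * Real.cos θ ^ 2 * √(realRadicand s θ)) -
      (2 * s ^ 2 * (Real.sin θ ^ 2 * (√(realRadicand s θ))⁻¹) +
        Real.sin θ ^ 0 * Real.cos θ ^ 2 * √(realRadicand s θ))) ?_ (by fun_prop) (by simp) (by simp)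
  · rw [intervalIntegral.integral_sub (Continuous.intervalIntegrable (by fun_prop) _ _)
      (Continuous.intervalIntegrable (by fun_prop) _ _), intervalIntegral.integral_const_mul,
      intervalIntegral.integral_add (Continuous.intervalIntegrable (by fun_prop) _ _)
      (Continuous.intervalIntegrable (by fun_prop) _ _), intervalIntegral.integral_const_mul] at h0
    exact sub_eq_zero.1 h0
  · intro θ
    have hS := hasDerivAt_sqrt_realRadicand hs θ
    refine ((((((Real.hasDerivAt_sin θ).pow 3).mul (Real.hasDerivAt_cos θ)).mul hS).const_mul
      (1 + s)).sub (((Real.hasDerivAt_sin θ).mul (Real.hasDerivAt_cos θ)).mul hS)).congr_deriv ?_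
    have hp := Real.sqrt_pos.2 (realRadicand_pos hs θ)
    have hsq := Real.sq_sqrt (realRadicand_pos hs θ).le
    have hcos := Real.cos_sq' θ
    simp only [Pi.mul_apply, Pi.pow_apply]
    set w := √(realRadicand s θ)
    push_cast
    field_simp
    rw [hsq, realRadicand]
    set u := Real.sin θ
    set v := Real.cos θ
    have hv : v ^ 2 = 1 - u ^ 2 := hcos
    ring_nf
    simp only [hv]
    ring

theorem ovalIntegral_eq {h : ℝ} (hh : 0 < h) (n : ℕ) :
    ovalIntegral n h = √2 * (1 + √(1 + 4 * h)) * xmax h ^ n * areaMoment n (√(1 + 4 * h)) := by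
  have hsq := Real.sq_sqrt (show 0 ≤ 1 + 4 * h by linarith)
  have hs0 := Real.sqrt_nonneg (1 + 4 * h)
  set s := √(1 + 4 * h) with hs
  have hs1 : 1 < s := by nlinarith
  have hA : 0 ≤ 1 + s := by linarith
  have hx : xmax h ^ 2 = 1 + s := Real.sq_sqrt hA
  have hx0 : 0 ≤ xmax h := Real.sqrt_nonneg _
  have hbr : ∀ θ ∈ Icc (-(Real.pi / 2)) (Real.pi / 2),
      branch h (xmax h * Real.sin θ) = xmax h * Real.cos θ * √(realRadicand s θ) / √2 := by
    intro θ hθ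
    have hc : 0 ≤ Real.cos θ := Real.cos_nonneg_of_mem_Icc hθ
    have hp := Real.sq_sqrt (realRadicand_pos hs1 θ).le
    have h2 : √(2 : ℝ) ^ 2 = 2 := Real.sq_sqrt (by norm_num)
    have hcos := Real.cos_sq' θ
    have e : 2 * h + (xmax h * Real.sin θ) ^ 2 - (xmax h * Real.sin θ) ^ 4 / 2 =
        (xmax h * Real.cos θ * √(realRadicand s θ) / √2) ^ 2 := by
      rw [div_pow, mul_pow, mul_pow, mul_pow, mul_pow, show xmax h ^ 4 = (xmax h ^ 2) ^ 2 by ring,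
        hx, hp, h2, hcos, realRadicand]
      linear_combination -hsq / 2
    rw [branch, e, Real.sqrt_sq (by positivity)]
  have hsub : ∫ x in (-xmax h)..(xmax h), x ^ n * branch h x =
      ∫ θ in (-(Real.pi / 2))..(Real.pi / 2), (xmax h * Real.sin θ) ^ n *
        branch h (xmax h * Real.sin θ) * (xmax h * Real.cos θ) := by
    have hcb : Continuous fun x => x ^ n * branch h x := by
      unfold branch
      fun_prop
    have := intervalIntegral.integral_comp_mul_deriv (a := -(Real.pi / 2)) (b := Real.pi / 2)
      (f := fun θ => xmax h * Real.sin θ) (f' := fun θ => xmax h * Real.cos θ)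
      (g := fun x => x ^ n * branch h x)
      (fun θ _ => (Real.hasDerivAt_sin θ).const_mul _) (by fun_prop) hcb
    simpa using this.symm
  have hneg : ∫ x in (xmax h)..(-xmax h), x ^ n * (-branch h x) =
      ∫ x in (-xmax h)..(xmax h), x ^ n * branch h x := by
    rw [intervalIntegral.integral_symm]
    simp
  have h2 : √2 * √2 = 2 := Real.mul_self_sqrt (by norm_num)
  have h2' : √2 ≠ 0 := by positivity
  rw [ovalIntegral, hneg, hsub, ← two_mul, areaMoment, ← intervalIntegral.integral_const_mul,
    ← intervalIntegral.integral_const_mul]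
  refine intervalIntegral.integral_congr fun θ hθ => ?_
  rw [uIcc_of_le (by linarith [Real.pi_pos])] at hθ
  rw [hbr θ hθ, ← hx, mul_pow]
  field_simp
  linear_combination -(xmax h ^ n * xmax h ^ 2 * Real.sin θ ^ n * Real.cos θ ^ 2 * √(realRadicand s θ)) * h2

end real

/-! ### Passage from `s` to the energy `h` -/

/-- The branch of `√(1 + 4h)` with positive real part. -/
noncomputable def root (h : ℂ) : ℂ := exp (log (1 + 4 * h) / 2)

theorem one_add_mem {h : ℂ} (hh : h ∈ slitPlane) : 1 + 4 * h ∈ slitPlane := by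
  rw [mem_slitPlane_iff] at *
  have e1 : (1 + 4 * h).re = 1 + 4 * h.re := by simp
  have e2 : (1 + 4 * h).im = 4 * h.im := by simp
  rw [e1, e2]
  rcases hh with h' | h'
  · left; linarith
  · right; simpa using h'

theorem root_sq {h : ℂ} (hh : h ∈ slitPlane) : root h ^ 2 = 1 + 4 * h := by
  rw [root, ← exp_nat_mul]
  push_cast
  rw [mul_div_cancel₀ _ two_ne_zero, exp_log (slitPlane_ne_zero (one_add_mem hh))]

theorem re_root_pos {h : ℂ} (hh : h ∈ slitPlane) : 0 < (root h).re := by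
  have h1 := (mem_slitPlane_iff_arg.1 (one_add_mem hh)).1
  have h2 := neg_pi_lt_arg (1 + 4 * h)
  have h3 := lt_of_le_of_ne (arg_le_pi (1 + 4 * h)) h1
  rw [root, exp_re]
  refine mul_pos (Real.exp_pos _) (Real.cos_pos_of_mem_Ioo ?_)
  rw [div_ofNat_im, log_im]
  exact ⟨by linarith, by linarith⟩

theorem re_mul_im_root {h : ℂ} (hh : h ∈ slitPlane) :
    (root h).re * (root h).im = 2 * h.im := by
  have := congrArg im (root_sq hh)
  rw [pow_two, mul_im] at this
  have e2 : (1 + 4 * h).im = 4 * h.im := by simp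
  linarith

theorem root_mem_upperPlane {h : ℂ} (hh : h ∈ upperPlane) : root h ∈ upperPlane := by
  have hs := upperPlane_subset_slitPlane hh
  have h1 := re_mul_im_root hs
  have h2 : 0 < h.im := hh
  change 0 < (root h).im
  exact pos_of_mul_pos_right (by linarith : 0 < (root h).re * (root h).im) (re_root_pos hs).le

theorem root_ofReal {h : ℝ} (hh : 0 < h) : root h = (√(1 + 4 * h) : ℝ) := by
  have hp : 0 < 1 + 4 * h := by linarith
  have e : (1 + 4 * (h : ℂ)) = ((1 + 4 * h : ℝ) : ℂ) := by push_cast; rfl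
  rw [root, e, ← ofReal_log hp.le]
  conv_rhs => rw [← Real.exp_log hp, ← Real.exp_half]
  push_cast
  rfl

theorem one_lt_sqrt {h : ℝ} (hh : 0 < h) : 1 < √(1 + 4 * h) := by
  rw [Real.lt_sqrt zero_le_one]
  linarith

theorem root_conj {h : ℂ} (hh : h ∈ slitPlane) : root (conj h) = conj (root h) := by
  have e : 1 + 4 * conj h = conj (1 + 4 * h) := by
    simp only [map_add, map_mul, map_one, map_ofNat]
  rw [root, e, log_conj _ (mem_slitPlane_iff_arg.1 (one_add_mem hh)).1, root, ← exp_conj, map_div₀,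
    map_ofNat]

theorem root_mem {h : ℂ} (hh : h ∈ slitPlane) : root h ∈ rootDomain := by
  rcases mem_slitPlane_cases hh with hu | hu | ⟨x, hx, rfl⟩
  · exact mem_rootDomain_of_upperPlane (re_root_pos hh) (root_mem_upperPlane hu)
  · have := conj_mem_rootDomain (mem_rootDomain_of_upperPlane (re_root_pos (conj_mem hh))
      (root_mem_upperPlane hu))
    rwa [root_conj hh, conj_conj] at this
  · have h1 := one_lt_sqrt hx
    rw [root_ofReal hx]
    refine ⟨by simp only [mem_ofPred_eq, ofReal_re]; linarith, Or.inl ?_⟩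
    rw [sub_re, ofReal_re, one_re]
    linarith

theorem differentiableOn_root : DifferentiableOn ℂ root slitPlane := by
  have h1 : DifferentiableOn ℂ (fun h : ℂ => 1 + 4 * h) slitPlane := by fun_prop
  exact ((h1.clog fun h hh => one_add_mem hh).div_const 2).cexp

/-- The moments as functions of the energy. -/
noncomputable def energyMoment (n : ℕ) (h : ℂ) : ℂ := moment n (root h)

theorem differentiableOn_energyMoment (n : ℕ) :
    DifferentiableOn ℂ (energyMoment n) slitPlane :=
  (differentiableOn_moment n).comp differentiableOn_root fun _ hh => root_mem hh

theorem energyMoment_conj (n : ℕ) {h : ℂ} (hh : h ∈ slitPlane) :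
    energyMoment n (conj h) = conj (energyMoment n h) := by
  rw [energyMoment, root_conj hh, moment_conj (root_mem hh), energyMoment]

theorem energyMoment_ofReal (n : ℕ) {h : ℝ} (hh : 0 < h) :
    energyMoment n h = (realMoment n √(1 + 4 * h) : ℝ) := by
  rw [energyMoment, root_ofReal hh, moment_ofReal (one_lt_sqrt hh)]

/-- Off the real axis, a zero would contradict the strict positivity in `im_moment_pos`; on the
positive axis the integrand is nonnegative and not identically zero. -/
theorem energyMoment_two_ne_zero {h : ℂ} (hh : h ∈ slitPlane) : energyMoment 2 h ≠ 0 := by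
  have hup : ∀ h ∈ upperPlane, energyMoment 2 h ≠ 0 := by
    intro h hu h0
    have := im_moment_pos (re_root_pos (upperPlane_subset_slitPlane hu)) (root_mem_upperPlane hu)
    rw [energyMoment] at h0
    simp [h0] at this
  rcases mem_slitPlane_cases hh with hu | hu | ⟨x, hx, rfl⟩
  · exact hup h hu
  · intro h0
    refine hup _ hu ?_
    rw [energyMoment_conj 2 hh, h0, map_zero]
  · rw [energyMoment_ofReal 2 hx]
    exact ofReal_ne_zero.2 (realMoment_two_pos (one_lt_sqrt hx)).ne'

/-! ### The ratio of moments is a non-affine Pick function -/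

/-- The quotient of elliptic integrals governing the zeros of the Melnikov function. -/
noncomputable def ratio (h : ℂ) : ℂ := (root h - 1) * energyMoment 0 h / energyMoment 2 h

theorem isPick_ratio : IsPick ratio where
  diff := ((differentiableOn_root.sub_const 1).mul (differentiableOn_energyMoment 0)).div
    (differentiableOn_energyMoment 2) fun _ hh => energyMoment_two_ne_zero hh
  mapsTo h hh := by
    have hs := upperPlane_subset_slitPlane hh
    have h1 := im_moment_pos (re_root_pos hs) (root_mem_upperPlane hh)
    have h2 : 0 < normSq (energyMoment 2 h) := normSq_pos.2 (energyMoment_two_ne_zero hs)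
    change 0 < (ratio h).im
    have e : ratio h = (((normSq (energyMoment 2 h))⁻¹ : ℝ) : ℂ) *
        ((root h - 1) * moment 0 (root h) * conj (moment 2 (root h))) := by
      rw [ratio, div_eq_mul_inv, inv_def]
      simp only [energyMoment]
      ring
    rw [e, im_ofReal_mul]
    positivity
  map_conj h hh := by
    simp only [ratio, root_conj hh, energyMoment_conj _ hh, map_div₀, map_mul, map_sub, map_one]

theorem isPreconnected_slitPlane : IsPreconnected slitPlane :=
  (starConvex_one_slitPlane.isPathConnected
    one_mem_slitPlane).isConnected.isPreconnected

/-- With `h = (s² - 1) / 4` real, the ratio is at most `4 (s - 1)`, which is of order `√h`; an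
affine ratio would therefore be constant, contradicting its positive derivative. -/
theorem ratio_not_affine : ¬ ∃ c d : ℂ, ∀ z ∈ upperPlane, ratio z = c + d * z := by
  rintro ⟨c, d, hcd⟩
  have heq : EqOn ratio (fun z => c + d * z) slitPlane := by
    refine (isPick_ratio.diff.analyticOnNhd isOpen_slitPlane).eqOn_of_preconnected_of_eventuallyEq
      (DifferentiableOn.analyticOnNhd (by fun_prop) isOpen_slitPlane) isPreconnected_slitPlane
      (upperPlane_subset_slitPlane I_mem_upperPlane) ?_
    filter_upwards [isOpen_upperPlane.mem_nhds I_mem_upperPlane] with z hz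
    exact hcd z hz
  have hbound : ∀ s : ℝ, 2 ≤ s → ‖d‖ * (s ^ 2 - 1) ≤ 16 * (s - 1) + 4 * ‖c‖ := by
    intro s hs
    have hh : 0 < (s ^ 2 - 1) / 4 := by nlinarith
    have hr : √(1 + 4 * ((s ^ 2 - 1) / 4)) = s := by
      rw [show 1 + 4 * ((s ^ 2 - 1) / 4) = s ^ 2 by ring, Real.sqrt_sq (by linarith)]
    have h1 := heq (ofReal_mem hh)
    obtain ⟨b1, b2⟩ := realMoment_bounds hs
    have b3 := realMoment_two_pos (s := s) (by linarith)
    have h2 : ratio ((s ^ 2 - 1) / 4 : ℝ) = ((s - 1) * realMoment 0 s / realMoment 2 s : ℝ) := by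
      rw [ratio, energyMoment_ofReal _ hh, energyMoment_ofReal _ hh, root_ofReal hh, hr]
      push_cast
      rfl
    have h3 : ‖ratio ((s ^ 2 - 1) / 4 : ℝ)‖ ≤ 4 * (s - 1) := by
      have : 0 ≤ s - 1 := by linarith
      rw [h2, norm_real, Real.norm_eq_abs, abs_of_nonneg (by positivity), div_le_iff₀ b3]
      nlinarith
    have h4 : d * ((s ^ 2 - 1) / 4 : ℝ) = ratio ((s ^ 2 - 1) / 4 : ℝ) - c := by
      rw [h1]; ring
    have h5 := norm_sub_le (ratio ((s ^ 2 - 1) / 4 : ℝ)) c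
    rw [← h4, norm_mul, norm_real, Real.norm_eq_abs, abs_of_pos hh] at h5
    linarith
  have hd : d = 0 := by
    by_contra hd
    have hδ : 0 < ‖d‖ := norm_pos_iff.2 hd
    have hc := norm_nonneg c
    have hq : 0 ≤ (16 + 4 * ‖c‖) / ‖d‖ := by positivity
    -- This `s` satisfies `‖d‖ (s - 2) = 16 + 4 ‖c‖`, which makes the left side of `hbound` exceed
    -- the right.
    have hb := hbound (2 + (16 + 4 * ‖c‖) / ‖d‖) (by linarith)
    set s := 2 + (16 + 4 * ‖c‖) / ‖d‖ with hs
    have e : ‖d‖ * (s - 2) = 16 + 4 * ‖c‖ := by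
      rw [hs, add_sub_cancel_left, mul_div_cancel₀ _ hδ.ne']
    have e2 : ‖d‖ * (s ^ 2 - 1) = (16 + 4 * ‖c‖) * (s - 1) + 3 * ‖d‖ * (s - 1) := by
      linear_combination (s - 1) * e
    have : 0 ≤ (4 * ‖c‖) * (s - 2) := by
      have : 0 ≤ s - 2 := by linarith
      positivity
    have : 0 < 3 * ‖d‖ * (s - 1) := by
      have : 0 < s - 1 := by linarith
      positivity
    nlinarith
  have hder := isPick_ratio.re_deriv_pos one_pos
  have hconst : ratio =ᶠ[𝓝 ((1 : ℝ) : ℂ)] fun _ => c := by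
    filter_upwards [isOpen_slitPlane.mem_nhds (ofReal_mem one_pos)] with z hz
    simpa only [hd, zero_mul, add_zero] using heq hz
  rw [hconst.deriv_eq, deriv_const] at hder
  simp at hder

/-! ### The Abelian integrals -/

/-- The analytic continuation of `ovalIntegral 0`. -/
noncomputable def abelian₀ (h : ℂ) : ℂ :=
  ((√2 * (2 / 3) : ℝ) : ℂ) * (1 + root h) * ((root h - 1) * energyMoment 0 h + energyMoment 2 h)

/-- The analytic continuation of `ovalIntegral 2`. -/
noncomputable def abelian₂ (h : ℂ) : ℂ :=
  (((2 * √2 : ℝ) : ℂ) * (1 + root h) * root h ^ 2 * energyMoment 2 h + abelian₀ h) / 5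

theorem isAbelianIntegral₀ : IsAbelianIntegral 0 abelian₀ := by
  refine ⟨DifferentiableOn.analyticOnNhd ?_ isOpen_slitPlane, fun h hh => ?_⟩
  · exact ((differentiableOn_root.const_add 1).const_mul _).mul
      (((differentiableOn_root.sub_const 1).mul (differentiableOn_energyMoment 0)).add
        (differentiableOn_energyMoment 2))
  · have h0 := areaMoment_zero (one_lt_sqrt hh)
    rw [abelian₀, energyMoment_ofReal _ hh, energyMoment_ofReal _ hh, root_ofReal hh,
      ovalIntegral_eq hh]
    norm_cast
    rw [pow_zero, mul_one]
    linear_combination -(√2 * (1 + √(1 + 4 * h)) / 3) * h0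

theorem isAbelianIntegral₂ : IsAbelianIntegral 2 abelian₂ := by
  obtain ⟨ha, he⟩ := isAbelianIntegral₀
  refine ⟨DifferentiableOn.analyticOnNhd ?_ isOpen_slitPlane, fun h hh => ?_⟩
  · exact (((((differentiableOn_root.const_add 1).const_mul _).mul
      (differentiableOn_root.pow 2)).mul (differentiableOn_energyMoment 2)).add
        ha.differentiableOn).div_const 5
  · have h0 := areaMoment_two (one_lt_sqrt hh)
    have hx : xmax h ^ 2 = 1 + √(1 + 4 * h) :=
      Real.sq_sqrt (by linarith [Real.sqrt_nonneg (1 + 4 * h)])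
    rw [abelian₂, he h hh, energyMoment_ofReal _ hh, root_ofReal hh,
      ovalIntegral_eq hh, ovalIntegral_eq hh, hx]
    norm_cast
    rw [pow_zero, mul_one]
    linear_combination -(√2 * (1 + √(1 + 4 * h)) / 5) * h0

theorem eqOn_of_isAbelianIntegral {i : ℕ} {f g : ℂ → ℂ} (hf : IsAbelianIntegral i f)
    (hg : IsAbelianIntegral i g) : EqOn f g slitPlane := by
  have h1 : ((1 : ℝ) : ℂ) ∈ slitPlane := ofReal_mem one_pos
  refine hf.1.eqOn_of_preconnected_of_frequently_eq hg.1 isPreconnected_slitPlane h1 ?_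
  have ht : Tendsto (fun t : ℝ => (t : ℂ)) (𝓝[>] 1) (𝓝[≠] ((1 : ℝ) : ℂ)) := by
    refine tendsto_nhdsWithin_iff.2 ⟨(continuous_ofReal.tendsto 1).mono_left nhdsWithin_le_nhds, ?_⟩
    filter_upwards [self_mem_nhdsWithin] with t ht
    exact fun h' => (ne_of_gt ht) (ofReal_injective h')
  refine ht.frequently (Eventually.frequently ?_)
  filter_upwards [self_mem_nhdsWithin] with t ht
  have ht0 : 0 < t := one_pos.trans ht
  rw [hf.2 t ht0, hg.2 t ht0]

theorem sum_order_melnikov {l₀ l₂ : ℝ} (hl : l₀ ≠ 0 ∨ l₂ ≠ 0) {S : Finset ℂ}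
    (hS : ∀ z ∈ S, z ∈ slitPlane) :
    ∑ z ∈ S, analyticOrderAt (fun h : ℂ => (l₀ : ℂ) * abelian₀ h + (l₂ : ℂ) * abelian₂ h) z
      ≤ 2 := by
  -- The coefficients come from `abelian₀ = u (ratio + 1) / 3` and `abelian₂ = (u (1 + 4h) +
  -- abelian₀) / 5`, with `u` as below.
  set p : ℝ := (l₀ + l₂ / 5) / 3
  set q : ℝ := 4 * l₂ / 5
  set r : ℝ := (l₀ + l₂ / 5) / 3 + l₂ / 5
  have hpqr : p ≠ 0 ∨ q ≠ 0 ∨ r ≠ 0 := by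
    by_contra! h
    obtain ⟨hp, hq, -⟩ := h
    have h2 : l₂ = 0 := by simp only [q] at hq; linarith
    have h0 : l₀ = 0 := by simp only [p, h2] at hp; linarith
    exact hl.elim (fun h => h h0) fun h => h h2
  refine le_trans (Finset.sum_le_sum fun z hz => le_of_eq ?_)
    (isPick_ratio.sum_order_le_two ratio_not_affine hpqr hS)
  have hzS := hS z hz
  set u : ℂ → ℂ := fun h => ((2 * √2 : ℝ) : ℂ) * (1 + root h) * energyMoment 2 h
  have hu : AnalyticAt ℂ u z := by
    refine DifferentiableOn.analyticAt (s := slitPlane) ?_ (isOpen_slitPlane.mem_nhds hzS)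
    exact ((differentiableOn_root.const_add 1).const_mul _).mul (differentiableOn_energyMoment 2)
  have hu0 : u z ≠ 0 := by
    refine mul_ne_zero (mul_ne_zero (ofReal_ne_zero.2 (by positivity)) fun h' => ?_)
      (energyMoment_two_ne_zero hzS)
    have h1 := congrArg re h'
    have h2 := re_root_pos hzS
    rw [add_re, one_re, zero_re] at h1
    linarith
  have hfac : (fun h : ℂ => (l₀ : ℂ) * abelian₀ h + (l₂ : ℂ) * abelian₂ h) =ᶠ[𝓝 z]
      u * fun z => (p : ℂ) * ratio z + q * z + r := by
    filter_upwards [isOpen_slitPlane.mem_nhds hzS] with h hh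
    have hr : ratio h * energyMoment 2 h = (root h - 1) * energyMoment 0 h :=
      div_mul_cancel₀ _ (energyMoment_two_ne_zero hh)
    have hsq := root_sq hh
    simp only [abelian₀, abelian₂, Pi.mul_apply, u, p, q, r]
    push_cast
    rw [hsq, ← hr]
    ring
  rw [analyticOrderAt_congr hfac,
    analyticOrderAt_mul hu (isPick_ratio.analyticAt_comb hzS), hu.analyticOrderAt_eq_zero.2 hu0,
    zero_add]

end Duffing

end

theorem lemmaz1 :
    (∃ I₀ : ℂ → ℂ, Duffing.IsAbelianIntegral 0 I₀) ∧
    (∃ I₂ : ℂ → ℂ, Duffing.IsAbelianIntegral 2 I₂) ∧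
    ∀ I₀ I₂ : ℂ → ℂ, Duffing.IsAbelianIntegral 0 I₀ → Duffing.IsAbelianIntegral 2 I₂ →
      ∀ l₀ l₂ : ℝ, (l₀ ≠ 0 ∨ l₂ ≠ 0) →
        ∀ S : Finset ℂ, (∀ z ∈ S, z ∈ Complex.slitPlane) →
          ∑ z ∈ S, analyticOrderAt (fun h : ℂ => (l₀ : ℂ) * I₀ h + (l₂ : ℂ) * I₂ h) z
            ≤ (2 : ℕ∞) := by
  refine ⟨⟨_, Duffing.isAbelianIntegral₀⟩, ⟨_, Duffing.isAbelianIntegral₂⟩, ?_⟩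
  intro I₀ I₂ h₀ h₂ l₀ l₂ hl S hS
  have e₀ := Duffing.eqOn_of_isAbelianIntegral h₀ Duffing.isAbelianIntegral₀
  have e₂ := Duffing.eqOn_of_isAbelianIntegral h₂ Duffing.isAbelianIntegral₂
  refine le_trans (Finset.sum_le_sum fun z hz => le_of_eq (analyticOrderAt_congr ?_))
    (Duffing.sum_order_melnikov hl hS)
  filter_upwards [Complex.isOpen_slitPlane.mem_nhds (hS z hz)] with h hh
  rw [e₀ hh, e₂ hh]
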